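/- Let $\mathcal G$ be a connected, non-compact metric graph with finitely many vertices and edges (self-loops and multiple edges allowed). Each edge $e$ is identified with an interval $I_e=[0,\ell_e]$, $\ell_e\in[0,+\infty]$ ($I_e=[0,+\infty)$ if $\ell_e=+\infty$); the edges of infinite length, called halflines, are exactly those ending at a vertex at infinity, where the vertices at infinity have degree one and no two of them are connected by an edge. Non-compact means that there is at least one halfline. Let $H^1(\mathcal G)$ be the space of functions $u=(u_e)_e$, $u_e:I_e\to\mathbb C$, that are continuous on $\mathcal G$ (each $u_e$ is continuous on $I_e$, and at each vertex not at infinity the value does not depend on the edge chosen to reach it) and satisfy $u_e\in H^1(I_e)$ for every edge $e$. Let $p\in(2,6)$ and $\mu>0$, and put $$H^1_\mu(\mathcal G)=\Big\{u\in H^1(\mathcal G):\ \sum_e\int_{I_e}|u_e|^2\,dx=\mu\Big\},\qquad E(u,\mathcal G)=\frac12\sum_e\int_{I_e}|u_e'|^2\,dx-\frac1p\sum_e\int_{I_e}|u_e|^p\,dx .$$ Let $\phi_\mu(x)=C\mu^{\frac2{6-p}}\,\mathrm{sech}^{\frac2{p-2}}\big(c\,\mu^{\frac{p-2}{6-p}}x\big)$,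 $x\in\mathbb R$, be the soliton of mass $\mu$, where $C,c>0$ are the constants, depending only on $p$, for which $\int_{\mathbb R}\phi_\mu^2\,dx=\mu$ and $\phi_\mu''+\phi_\mu^{p-1}=\omega\phi_\mu$ for some $\omega\in\mathbb R$; explicitly $$c=\Big(\big(\tfrac{2p}{(p-2)^2}\big)^{\frac2{p-2}}\int_{\mathbb R}\mathrm{sech}^{\frac4{p-2}}x\,dx\Big)^{-\frac{p-2}{6-p}},\qquad C=\Big(\tfrac{2p}{(p-2)^2}\,c^2\Big)^{\frac1{p-2}},$$ and let $E(\phi_\mu,\mathbb R)=\frac12\int_{\mathbb R}|\phi_\mu'|^2\,dx-\frac1p\int_{\mathbb R}|\phi_\mu|^p\,dx$. If there exists $u\in H^1_\mu(\mathcal G)$ with $E(u,\mathcal G)\le E(\phi_\mu,\mathbb R)$, then $\mathcal G$ admits a ground state of mass $\mu$, that is, $E(\cdot,\mathcal G)$ attains its minimum on $H^1_\mu(\mathcal G)$. -/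

import Mathlib

open MeasureTheory
open scoped ContDiff

/-- A (finite, when `V` and `E` are finite) metric graph with vertex set `V` and edge set `E`.
Self-loops and multiple edges are allowed. Some vertices are vertices at infinity. Every edge `e`
carries a length in `[0, ∞]` and is parametrized from `src e` (at `x = 0`) to `tgt e`. The edges
of infinite length are the halflines: they are exactly those that end at a vertex at infinity, and
they are parametrized starting from their vertex at finite distance. So no edge connects
two vertices at infinity, and each vertex at infinity has degree one. -/
structure MetricGraph (V E : Type*) where
  /-- the vertices at infinity -/
  infVertices : Set V
  /-- the vertex at `x = 0` -/
  src : E → V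
  /-- the vertex at the other end -/
  tgt : E → V
  /-- the length of an edge -/
  len : E → ENNReal
  src_notMem : ∀ e, src e ∉ infVertices
  tgt_mem_iff : ∀ e, tgt e ∈ infVertices ↔ len e = ⊤
  existsUnique_edge : ∀ v ∈ infVertices, ∃! e, tgt e = v

/-- `g` is a weak derivative of `f` on the open set `U ⊆ ℝ`:
`∫_U φ' f = - ∫_U φ g` for all `φ ∈ C_c^∞(U)`. -/
def HasWeakDerivOn (U : Set ℝ) (f g : ℝ → ℂ) : Prop :=
  ∀ φ : ℝ → ℝ, ContDiff ℝ ∞ φ → HasCompactSupport φ → tsupport φ ⊆ U →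
    ∫ x in U, deriv φ x • f x = - ∫ x in U, φ x • g x

/-- A square integrable weak derivative is unique almost everywhere. -/
theorem HasWeakDerivOn.ae_unique {U : Set ℝ} (hU : IsOpen U) {f g h : ℝ → ℂ}
    (hg : HasWeakDerivOn U f g) (hh : HasWeakDerivOn U f h)
    (hg2 : MemLp g 2 (volume.restrict U)) (hh2 : MemLp h 2 (volume.restrict U)) :
    g =ᵐ[volume.restrict U] h := by
  have hgl : LocallyIntegrableOn g U := by
    rw [locallyIntegrableOn_iff hU.isLocallyClosed]
    intro k hk hkc
    have : IsFiniteMeasure (volume.restrict k) := ⟨by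
      rw [Measure.restrict_apply_univ]; exact hkc.measure_lt_top⟩
    exact (hg2.mono_measure (Measure.restrict_mono hk le_rfl)).integrable (by norm_num)
  have hhl : LocallyIntegrableOn h U := by
    rw [locallyIntegrableOn_iff hU.isLocallyClosed]
    intro k hk hkc
    have : IsFiniteMeasure (volume.restrict k) := ⟨by
      rw [Measure.restrict_apply_univ]; exact hkc.measure_lt_top⟩
    exact (hh2.mono_measure (Measure.restrict_mono hk le_rfl)).integrable (by norm_num)
  have hi : ∀ w : ℝ → ℂ, LocallyIntegrableOn w U → ∀ φ : ℝ → ℝ, ContDiff ℝ ∞ φ →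
      HasCompactSupport φ → tsupport φ ⊆ U →
      IntegrableOn (fun x => φ x • w x) U ∧ ∫ x, φ x • w x = ∫ x in U, φ x • w x := by
    intro w hw φ hφ hc hs
    have h0 : ∀ x, x ∉ tsupport φ → φ x • w x = 0 := fun x hx => by
      rw [image_eq_zero_of_notMem_tsupport hx, zero_smul]
    refine ⟨?_, (setIntegral_eq_integral_of_forall_compl_eq_zero
      fun x hx => h0 x fun hx' => hx (hs hx')).symm⟩
    have h1 : IntegrableOn w (tsupport φ) := hw.integrableOn_compact_subset hs hc
    have h2 : IntegrableOn (fun x => φ x • w x) (tsupport φ) :=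
      h1.continuousOn_smul hφ.continuous.continuousOn hc
    exact ((integrableOn_iff_integrable_of_support_subset fun x hx => by
      by_contra hx'
      exact hx (h0 x hx')).1 h2).integrableOn
  have hz := hU.ae_eq_zero_of_integral_contDiff_smul_eq_zero (μ := volume) (f := g - h)
    (hgl.sub hhl) (fun φ hφ hc hs => by
      obtain ⟨ig, eg⟩ := hi g hgl φ hφ hc hs
      obtain ⟨ih, eh⟩ := hi h hhl φ hφ hc hs
      rw [(hi (g - h) (hgl.sub hhl) φ hφ hc hs).2]
      simp only [Pi.sub_apply, smul_sub]
      rw [integral_sub ig ih, sub_eq_zero]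
      exact neg_injective ((hg φ hφ hc hs).symm.trans (hh φ hφ hc hs)))
  refine (ae_restrict_iff' hU.measurableSet).2 ?_
  filter_upwards [hz] with x hx hxU
  exact sub_eq_zero.1 (hx hxU)

open Classical in
/-- The weak derivative of `f` in `L²(U)`, well defined almost everywhere on an open `U`
(and `0` by convention if there is none). -/
noncomputable def weakDeriv (U : Set ℝ) (f : ℝ → ℂ) : ℝ → ℂ :=
  if h : ∃ g, MemLp g 2 (volume.restrict U) ∧ HasWeakDerivOn U f g then h.choose else 0

namespace MetricGraph

variable {V E : Type*} (G : MetricGraph V E)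

/-- Any two vertices are joined by a chain of edges. -/
def Connected : Prop :=
  ∀ v w : V, Relation.EqvGen (fun a b => ∃ e, G.src e = a ∧ G.tgt e = b) v w

/-- The graph contains at least one halfline. -/
def Noncompact : Prop := ∃ e, G.len e = ⊤

/-- The interval `I_e = [0, ℓ_e]`, which is `[0, ∞)` for a halfline. -/
def interval (e : E) : Set ℝ := {x | 0 ≤ x ∧ ENNReal.ofReal x ≤ G.len e}

/-- The open interval `(0, ℓ_e)`. -/
def openInterval (e : E) : Set ℝ := {x | 0 < x ∧ ENNReal.ofReal x < G.len e}

/-- Functions on the graph are families `u = (u_e)`, where only the values of `u e` on the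
interval `I_e` matter. `u` is continuous if every `u_e` is continuous on `I_e` and the value of
`u` at each vertex (at finite distance) does not depend on the edge chosen to reach it. -/
def IsContinuous (u : E → ℝ → ℂ) : Prop :=
  (∀ e, ContinuousOn (u e) (G.interval e)) ∧
    ∃ c : V → ℂ, ∀ e, u e 0 = c (G.src e) ∧
      (G.len e ≠ ⊤ → u e (G.len e).toReal = c (G.tgt e))

/-- The space `H¹(G)`: continuous functions on `G` such that, on every edge, `u_e` is in `L²`
and has a weak derivative in `L²`. -/
def MemH1 (u : E → ℝ → ℂ) : Prop :=
  G.IsContinuous u ∧ ∀ e,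
    MemLp (u e) 2 (volume.restrict (G.interval e)) ∧
    ∃ g, MemLp g 2 (volume.restrict (G.openInterval e)) ∧
      HasWeakDerivOn (G.openInterval e) (u e) g

/-- The mass `‖u‖²_{L²(G)}`. -/
noncomputable def mass [Fintype E] (u : E → ℝ → ℂ) : ℝ :=
  ∑ e, ∫ x in G.interval e, ‖u e x‖ ^ 2

/-- The space `H¹_μ(G)` of the functions in `H¹(G)` of mass `μ`. -/
def MemH1Mass [Fintype E] (μ : ℝ) (u : E → ℝ → ℂ) : Prop :=
  G.MemH1 u ∧ G.mass u = μ

/-- The energy `E(u, G) = ½ ‖u'‖²_{L²(G)} - (1/p) ‖u‖^p_{L^p(G)}`. -/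
noncomputable def energy [Fintype E] (p : ℝ) (u : E → ℝ → ℂ) : ℝ :=
  1 / 2 * (∑ e, ∫ x in G.openInterval e, ‖weakDeriv (G.openInterval e) (u e) x‖ ^ 2)
    - 1 / p * (∑ e, ∫ x in G.interval e, ‖u e x‖ ^ p)

/-- `u` is a ground state of mass `μ`: a minimizer of the energy in `H¹_μ(G)`. -/
def IsGroundState [Fintype E] (p μ : ℝ) (u : E → ℝ → ℂ) : Prop :=
  G.MemH1Mass μ u ∧ ∀ v, G.MemH1Mass μ v → G.energy p u ≤ G.energy p v

end MetricGraph

/-- The energy `E(φ, ℝ)` on the real line, for continuously differentiable `φ`. -/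
noncomputable def lineEnergy (p : ℝ) (φ : ℝ → ℝ) : ℝ :=
  1 / 2 * (∫ x, deriv φ x ^ 2) - 1 / p * (∫ x, |φ x| ^ p)

/-- The constant `c`, depending on `p` only, in the soliton
`φ_μ(x) = C μ^{2/(6-p)} sech^{2/(p-2)}(c μ^{(p-2)/(6-p)} x)`. The pair `(C, c)` is the one pair of
positive constants for which `φ_μ` has mass `μ` and `φ'' + φ^{p-1} = ω φ` for some `ω`. -/
noncomputable def solitonWidth (p : ℝ) : ℝ :=
  ((2 * p / (p - 2) ^ 2) ^ (2 / (p - 2)) *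
    ∫ x, (Real.cosh x)⁻¹ ^ (4 / (p - 2))) ^ (-((p - 2) / (6 - p)))

/-- The constant `C`, depending on `p` only, in the soliton. -/
noncomputable def solitonHeight (p : ℝ) : ℝ :=
  (2 * p / (p - 2) ^ 2 * solitonWidth p ^ 2) ^ (1 / (p - 2))

/-- The soliton of mass `μ` on the real line,
`φ_μ(x) = C μ^{2/(6-p)} sech^{2/(p-2)}(c μ^{(p-2)/(6-p)} x)`. For `p = 4` it is
`μ / (2√2) sech(μ x / 4)`. -/
noncomputable def soliton (p μ : ℝ) (x : ℝ) : ℝ :=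
  solitonHeight p * μ ^ (2 / (6 - p)) *
    (Real.cosh (solitonWidth p * μ ^ ((p - 2) / (6 - p)) * x))⁻¹ ^ (2 / (p - 2))

/-! Let `I` be the infimum of the energy at mass `μ`. A minimizing sequence is bounded in H¹ because
`p < 6` (`exists_deriv_le_energy`), so along a subsequence it converges pointwise to some `v` while
the derivatives converge weakly (`HasL2Deriv.exists_subseq_tendsto`). Mass and energy then split
asymptotically between `v` and the remainder, in the manner of Brezis and Lieb
(`HasL2Deriv.tendsto_sub`). Let `m` be the mass of `v`.

Suppose `m > 0`. Rescaling to mass `μ` shows that a function of mass `m' ≤ μ` has energy at least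
`(m'/μ) I`, strictly more if `0 < m' < μ` (`HasL2Deriv.mass_div_mul_le_energy`). The bound for the
remainder forces the energy of `v` to be at most `(m/μ) I`, so `m < μ` is impossible and `v` attains
`I`.

Suppose `m = 0`. Then `I` is at least the soliton energy, so the competitor given by the hypothesis
is itself a ground state. The lower bound needs no rearrangement. Let `M` be the maximum of `|u|` on
the halflines, `W(s)² = (2/p)(M^(p-2) s² - s^p)`, and `Φ` the primitive of `W`. On halflines,
completing the square gives `½|u'|² - |u|^p/p + M^(p-2)|u|²/p ≥ W(|u|)|u'|`. Where the maximum is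
attained, `|u|` climbs to `M` and decays to 0, so the right side integrates to at least `2Φ(M)`
minus a vertex term. Thus `E(u) ≥ 2Φ(M) - μ M^(p-2)/p` up to errors from vertices and compact edges
that vanish in the limit, and Bernoulli's inequality bounds this function of `M` below by the
soliton energy (`lineEnergy_soliton_le`). -/

open Filter Set Topology

/-! ### Chain rule for the modulus of an absolutely continuous function -/

/-- Chain rule estimate for a primitive `u` of `g` and a `C¹` function `H` of `‖u‖`. -/
theorem abs_sub_comp_norm_le_integral {u g : ℝ → ℂ} {H K : ℝ → ℝ} {a b : ℝ} (hab : a ≤ b)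
    (hg : IntervalIntegrable g volume a b)
    (hu : ∀ x ∈ Icc a b, u x = u a + ∫ t in a..x, g t)
    (hH : ∀ s, HasDerivAt H (K s) s) (hK : Continuous K) :
    |H ‖u b‖ - H ‖u a‖| ≤ ∫ t in a..b, |K ‖u t‖| * ‖g t‖ := by
  have hsub : ∀ x ∈ Icc a b, ∀ y ∈ Icc a b, IntervalIntegrable g volume x y := fun x hx y hy =>
    hg.mono_set (by rw [uIcc_of_le hab]; exact (convex_Icc a b).ordConnected.uIcc_subset hx hy)
  have hdiff : ∀ x ∈ Icc a b, ∀ y ∈ Icc a b, u y - u x = ∫ t in x..y, g t := by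
    intro x hx y hy
    have ha := left_mem_Icc.2 hab
    rw [hu x hx, hu y hy, ← intervalIntegral.integral_add_adjacent_intervals
      (hsub a ha x hx) (hsub x hx y hy)]
    ring
  have hcont : ContinuousOn u (Icc a b) := by
    have h1 : ContinuousOn (fun x => u a + ∫ t in a..x, g t) (Icc a b) := by
      have := intervalIntegral.continuousOn_primitive_interval' hg left_mem_uIcc
      rw [uIcc_of_le hab] at this
      exact continuousOn_const.add this
    exact h1.congr hu
  have hHc : Continuous H := continuous_iff_continuousAt.2 fun s => (hH s).continuousAt
  have hint : ∀ ε : ℝ, IntervalIntegrable (fun t => (|K ‖u t‖| + ε) * ‖g t‖) volume a b := by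
    intro ε
    refine hg.norm.continuousOn_mul ?_
    rw [uIcc_of_le hab]
    exact ((hK.comp_continuousOn hcont.norm).abs).add continuousOn_const
  -- The modulus is not differentiable at 0, so the bound is propagated from `a` by continuity
  -- induction; the slack `ε` absorbs the oscillation of `K ‖u‖` on a short interval.
  have key : ∀ ε > 0, |H ‖u b‖ - H ‖u a‖| ≤ ∫ t in a..b, (|K ‖u t‖| + ε) * ‖g t‖ := by
    intro ε hε
    set F : ℝ → ℝ := fun x => ∫ t in a..x, (|K ‖u t‖| + ε) * ‖g t‖ with hF
    have hFc : ContinuousOn F (Icc a b) := by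
      have := intervalIntegral.continuousOn_primitive_interval' (hint ε) left_mem_uIcc
      rwa [uIcc_of_le hab] at this
    have hsI : ∀ x ∈ Icc a b, ∀ y ∈ Icc a b,
        IntervalIntegrable (fun t => (|K ‖u t‖| + ε) * ‖g t‖) volume x y := fun x hx y hy =>
      (hint ε).mono_set (by
        rw [uIcc_of_le hab]; exact (convex_Icc a b).ordConnected.uIcc_subset hx hy)
    let s : Set ℝ := {x | |H ‖u x‖ - H ‖u a‖| ≤ F x}
    have hclosed : IsClosed (s ∩ Icc a b) := by
      have : s ∩ Icc a b = Icc a b ∩ {x | |H ‖u x‖ - H ‖u a‖| ≤ F x} := inter_comm _ _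
      rw [this]
      exact isClosed_Icc.isClosed_le
        (((hHc.comp_continuousOn hcont.norm).sub continuousOn_const).abs) hFc
    have hsubset : Icc a b ⊆ s := by
      refine hclosed.Icc_subset_of_forall_mem_nhdsWithin (by simp [s, hF]) ?_
      rintro x ⟨hxs, hx⟩
      have hxI : x ∈ Icc a b := Ico_subset_Icc_self hx
      obtain ⟨η, hη, hKη⟩ := Metric.continuousAt_iff.1 (hK.continuousAt (x := ‖u x‖)) (ε / 2)
        (by positivity)
      have hux : ContinuousWithinAt u (Ioi x) x :=
        ((hcont x hxI).mono_of_mem_nhdsWithin (Icc_mem_nhdsGT_of_mem hx))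
      obtain ⟨δ, hδ, hδu⟩ := Metric.continuousWithinAt_iff.1 hux η hη
      have hnear : ∀ z ∈ Ico x (x + δ), ‖u z‖ ∈ Metric.ball ‖u x‖ η := by
        intro z hz
        rcases eq_or_lt_of_le hz.1 with rfl | hlt
        · exact Metric.mem_ball_self hη
        · have := hδu (mem_Ioi.2 hlt) (by
            rw [Real.dist_eq, abs_of_nonneg (by linarith)]; linarith [hz.2])
          rw [Metric.mem_ball, Real.dist_eq]
          exact (abs_norm_sub_norm_le _ _).trans_lt (by rwa [dist_eq_norm] at this)
      filter_upwards [Ioo_mem_nhdsGT (show x < min b (x + δ) from lt_min hx.2 (by linarith))]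
        with y hy
      have hyb : y < b := hy.2.trans_le (min_le_left _ _)
      have hyd : y < x + δ := hy.2.trans_le (min_le_right _ _)
      have hyI : y ∈ Icc a b := ⟨hx.1.trans hy.1.le, hyb.le⟩
      have hbd : ∀ s ∈ Metric.ball ‖u x‖ η, ‖K s‖ ≤ |K ‖u x‖| + ε / 2 := by
        intro s hs
        have h1 := hKη hs
        rw [Real.dist_eq] at h1
        have h2 := abs_sub_abs_le_abs_sub (K s) (K ‖u x‖)
        rw [Real.norm_eq_abs]
        linarith
      -- Half of `ε` pays for the mean value bound around `‖u x‖`, the other half for returning from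
      -- `K ‖u x‖` to `K ‖u t‖` in `hstep`.
      have hlip : |H ‖u y‖ - H ‖u x‖| ≤ (|K ‖u x‖| + ε / 2) * |‖u y‖ - ‖u x‖| := by
        have := (convex_ball ‖u x‖ η).norm_image_sub_le_of_norm_hasDerivWithin_le
          (f := H) (f' := K) (fun s _ => (hH s).hasDerivWithinAt) hbd
          (Metric.mem_ball_self hη) (hnear y ⟨hy.1.le, hyd⟩)
        simpa [Real.norm_eq_abs] using this
      have hnorm : |‖u y‖ - ‖u x‖| ≤ ∫ t in x..y, ‖g t‖ := by
        refine (abs_norm_sub_norm_le _ _).trans ?_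
        rw [hdiff x hxI y hyI]
        exact intervalIntegral.norm_integral_le_integral_norm hy.1.le
      have hstep : (|K ‖u x‖| + ε / 2) * ∫ t in x..y, ‖g t‖
          ≤ ∫ t in x..y, (|K ‖u t‖| + ε) * ‖g t‖ := by
        rw [← intervalIntegral.integral_const_mul]
        refine intervalIntegral.integral_mono_on hy.1.le ((hsub x hxI y hyI).norm.const_mul _)
          (hsI x hxI y hyI) fun t ht => ?_
        refine mul_le_mul_of_nonneg_right ?_ (norm_nonneg _)
        have h1 := hKη (hnear t ⟨ht.1, ht.2.trans_lt hyd⟩)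
        rw [Real.dist_eq, abs_sub_comm] at h1
        have h2 := abs_sub_abs_le_abs_sub (K ‖u x‖) (K ‖u t‖)
        linarith
      have hFy : F y = F x + ∫ t in x..y, (|K ‖u t‖| + ε) * ‖g t‖ :=
        (intervalIntegral.integral_add_adjacent_intervals
          (hsI a (left_mem_Icc.2 hab) x hxI) (hsI x hxI y hyI)).symm
      have hxs' : |H ‖u x‖ - H ‖u a‖| ≤ F x := hxs
      have h3 := mul_le_mul_of_nonneg_left hnorm (show 0 ≤ |K ‖u x‖| + ε / 2 by positivity)
      show |H ‖u y‖ - H ‖u a‖| ≤ F y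
      have h4 := abs_sub_le (H ‖u y‖) (H ‖u x‖) (H ‖u a‖)
      linarith
    exact hsubset (right_mem_Icc.2 hab)
  have hlim : Tendsto (fun ε : ℝ => ∫ t in a..b, (|K ‖u t‖| + ε) * ‖g t‖) (𝓝[>] 0)
      (𝓝 (∫ t in a..b, |K ‖u t‖| * ‖g t‖)) := by
    have h0 : IntervalIntegrable (fun t => |K ‖u t‖| * ‖g t‖) volume a b := by
      simpa using hint 0
    have : (fun ε : ℝ => ∫ t in a..b, (|K ‖u t‖| + ε) * ‖g t‖) =
        fun ε => (∫ t in a..b, |K ‖u t‖| * ‖g t‖) + ε * ∫ t in a..b, ‖g t‖ := by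
      funext ε
      rw [← intervalIntegral.integral_const_mul, ← intervalIntegral.integral_add h0
        (hg.norm.const_mul ε)]
      congr 1
      funext t
      ring
    rw [this]
    have hc : Continuous fun ε : ℝ =>
        (∫ t in a..b, |K ‖u t‖| * ‖g t‖) + ε * ∫ t in a..b, ‖g t‖ := by fun_prop
    simpa using (hc.tendsto 0).mono_left nhdsWithin_le_nhds
  exact ge_of_tendsto hlim (eventually_mem_nhdsWithin.mono fun ε hε => key ε hε)

/-! ### Weak compactness in L² -/

/-- A bounded sequence in a separable Hilbert space has a weakly convergent subsequence. -/
theorem exists_subseq_tendsto_inner {H : Type*} [NormedAddCommGroup H] [InnerProductSpace ℂ H]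
    [CompleteSpace H] [TopologicalSpace.SeparableSpace H] {x : ℕ → H} {C : ℝ}
    (hx : ∀ n, ‖x n‖ ≤ C) :
    ∃ (y : H) (φ : ℕ → ℕ), StrictMono φ ∧
      ∀ z, Tendsto (fun n => inner ℂ (x (φ n)) z) atTop (𝓝 (inner ℂ y z)) := by
  -- By Riesz the sequence lives in the dual, where separability makes balls weak-* sequentially
  -- compact.
  obtain ⟨y, -, φ, hφ, hy⟩ := WeakDual.isSeqCompact_closedBall ℂ H (0 : StrongDual ℂ H) C
    (x := fun n => StrongDual.toWeakDual (InnerProductSpace.toDual ℂ H (x n))) (fun n => by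
      simpa using hx n)
  refine ⟨(InnerProductSpace.toDual ℂ H).symm (WeakDual.toStrongDual y), φ, hφ, fun z => ?_⟩
  have h := (WeakDual.eval_continuous z).tendsto y |>.comp hy
  rw [InnerProductSpace.toDual_symm_apply]
  exact h

theorem MeasureTheory.MemLp.integrable_inner_complex {α : Type*} [MeasurableSpace α]
    {ν : Measure α} {f k : α → ℂ} (hf : MemLp f 2 ν) (hk : MemLp k 2 ν) :
    Integrable (fun x => (inner ℂ (f x) (k x) : ℂ)) ν :=
  (hf.norm.integrable_mul hk.norm).mono' (hf.1.inner hk.1)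
    (ae_of_all _ fun _ => norm_inner_le_norm _ _)

/-- In a finite family of `L²` spaces bounded sequences have a common subsequence that converges
weakly. -/
theorem exists_subseq_tendsto_integral_inner {E : Type*} [Fintype E] (ν : E → Measure ℝ)
    [∀ e, SigmaFinite (ν e)] {g : ℕ → E → ℝ → ℂ} (hg : ∀ n e, MemLp (g n e) 2 (ν e)) {C : ℝ}
    (hC : ∀ n e, ∫ x, ‖g n e x‖ ^ 2 ∂ν e ≤ C) :
    ∃ (h : E → ℝ → ℂ) (φ : ℕ → ℕ), (∀ e, MemLp (h e) 2 (ν e)) ∧ StrictMono φ ∧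
      ∀ e, ∀ k : ℝ → ℂ, MemLp k 2 (ν e) →
        Tendsto (fun n => ∫ x, inner ℂ (g (φ n) e x) (k x) ∂ν e) atTop
          (𝓝 (∫ x, inner ℂ (h e x) (k x) ∂ν e)) := by
  classical
  have : Fact ((1 : ENNReal) ≤ 2) := ⟨by norm_num⟩
  have : Fact ((2 : ENNReal) ≠ ⊤) := ⟨by norm_num⟩
  have hsep : TopologicalSpace.SeparableSpace (PiLp 2 fun e => Lp ℂ 2 (ν e)) :=
    (PiLp.homeomorph 2 fun e => Lp ℂ 2 (ν e)).symm.surjective.denseRange.separableSpace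
      (PiLp.homeomorph 2 fun e => Lp ℂ 2 (ν e)).symm.continuous
  -- In the Hilbert sum of the L² spaces one extraction serves all edges; vectors with a single
  -- nonzero component recover each edge.
  let X : ℕ → PiLp 2 fun e => Lp ℂ 2 (ν e) := fun n => WithLp.toLp 2 fun e => (hg n e).toLp (g n e)
  have hin : ∀ e, ∀ a b : ℝ → ℂ, ∀ (ha : MemLp a 2 (ν e)) (hb : MemLp b 2 (ν e)),
      inner ℂ (ha.toLp a) (hb.toLp b) = ∫ x, inner ℂ (a x) (b x) ∂ν e := by
    intro e a b ha hb
    rw [L2.inner_def]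
    refine integral_congr_ae ?_
    filter_upwards [ha.coeFn_toLp, hb.coeFn_toLp] with x hx hy
    rw [hx, hy]
  have hX : ∀ n, ‖X n‖ ≤ √(Fintype.card E * C) := by
    intro n
    rw [PiLp.norm_eq_of_L2]
    refine Real.sqrt_le_sqrt ?_
    calc ∑ e, ‖X n e‖ ^ 2 ≤ ∑ _e : E, C := Finset.sum_le_sum fun e _ => by
          have h1 : (inner ℂ (X n e) (X n e) : ℂ) = ∫ x, inner ℂ (g n e x) (g n e x) ∂ν e :=
            hin e _ _ (hg n e) (hg n e)
          have h2 : (∫ x, inner ℂ (g n e x) (g n e x) ∂ν e : ℂ).re = ∫ x, ‖g n e x‖ ^ 2 ∂ν e := by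
            have hi : Integrable (fun x => (inner ℂ (g n e x) (g n e x) : ℂ)) (ν e) :=
              (hg n e).integrable_inner_complex (hg n e)
            refine (integral_re hi).symm.trans ?_
            exact integral_congr_ae (ae_of_all _ fun x =>
              (norm_sq_eq_re_inner (𝕜 := ℂ) (g n e x)).symm)
          rw [norm_sq_eq_re_inner (𝕜 := ℂ), h1]
          refine le_trans (le_of_eq h2) ?_
          exact hC n e
      _ = Fintype.card E * C := by simp
  obtain ⟨Y, φ, hφ, hY⟩ := exists_subseq_tendsto_inner hX
  refine ⟨fun e => Y e, φ, fun e => Lp.memLp _, hφ, fun e k hk => ?_⟩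
  have h := hY (WithLp.toLp 2 (Pi.single e (hk.toLp k)))
  have hs : ∀ Z : PiLp 2 fun e => Lp ℂ 2 (ν e),
      inner ℂ Z (WithLp.toLp 2 (Pi.single e (hk.toLp k))) = inner ℂ (Z e) (hk.toLp k) := by
    intro Z
    rw [PiLp.inner_apply, Finset.sum_eq_single e]
    · simp
    · intro b _ hb
      simp [Pi.single_eq_of_ne hb]
    · simp
  simp_rw [hs] at h
  have h1 : inner ℂ (Y e) (hk.toLp k) = ∫ x, inner ℂ (Y e x) (k x) ∂ν e := by
    rw [← hin e _ _ (Lp.memLp (Y e)) hk, Lp.toLp_coeFn]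
  rw [h1] at h
  refine h.congr fun n => ?_
  exact hin e _ _ (hg (φ n) e) hk

/-! ### Brezis–Lieb splitting -/

/-- Weak convergence to zero, tested against a function in `L²`. -/
theorem tendsto_integral_norm_mul_norm {α : Type*} [MeasurableSpace α] {ν : Measure α}
    {w : ℕ → α → ℂ} {u : α → ℂ} {C : ℝ} (hw : ∀ n, MemLp (w n) 2 ν)
    (hC : ∀ n, ∫ x, ‖w n x‖ ^ 2 ∂ν ≤ C) (hu : MemLp u 2 ν)
    (hlim : ∀ᵐ x ∂ν, Tendsto (fun n => w n x) atTop (𝓝 0)) :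
    Tendsto (fun n => ∫ x, ‖w n x‖ * ‖u x‖ ∂ν) atTop (𝓝 0) := by
  have hw2 : ∀ n, Integrable (fun x => ‖w n x‖ ^ 2) ν := fun n =>
    (memLp_two_iff_integrable_sq_norm (hw n).1).1 (hw n)
  have hu2 : Integrable (fun x => ‖u x‖ ^ 2) ν := (memLp_two_iff_integrable_sq_norm hu.1).1 hu
  have hC0 : 0 ≤ C := (integral_nonneg fun x => by positivity).trans (hC 0)
  have hwu : ∀ n, Integrable (fun x => ‖w n x‖ * ‖u x‖) ν := fun n =>
    (hw n).norm.integrable_mul hu.norm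
  rw [Metric.tendsto_atTop]
  intro ε hε
  set δ : ℝ := ε / (2 * (C + 1)) with hδ
  have hδ0 : 0 < δ := by positivity
  -- Young's inequality: the positive part of `‖w‖‖u‖ - δ‖w‖²` has a dominating function independent
  -- of `n`, and the discarded `δ‖w‖²` integrates to less than `ε / 2` by the choice of `δ`.
  have hsplit : ∀ n, ∀ x, ‖w n x‖ * ‖u x‖ - δ * ‖w n x‖ ^ 2 ≤ (4 * δ)⁻¹ * ‖u x‖ ^ 2 := by
    intro n x
    have : 0 ≤ (4 * δ)⁻¹ * (‖u x‖ - 2 * δ * ‖w n x‖) ^ 2 := by positivity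
    have h2 : (4 * δ)⁻¹ * (‖u x‖ - 2 * δ * ‖w n x‖) ^ 2 =
      (4 * δ)⁻¹ * ‖u x‖ ^ 2 - ‖w n x‖ * ‖u x‖ + δ * ‖w n x‖ ^ 2 := by
      field_simp
      ring
    linarith
  have hT : Tendsto (fun n => ∫ x, max (‖w n x‖ * ‖u x‖ - δ * ‖w n x‖ ^ 2) 0 ∂ν) atTop
      (𝓝 (∫ _x, (0 : ℝ) ∂ν)) := by
    refine tendsto_integral_of_dominated_convergence (fun x => (4 * δ)⁻¹ * ‖u x‖ ^ 2)
      (fun n => ?_) (hu2.const_mul _) (fun n => ae_of_all _ fun x => ?_) ?_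
    · exact (((hwu n).sub ((hw2 n).const_mul δ)).sup (integrable_zero _ _ _)).1
    · rw [Real.norm_eq_abs, abs_of_nonneg (le_max_right _ _)]
      exact max_le (hsplit n x) (by positivity)
    · filter_upwards [hlim] with x hx
      have h1 := hx.norm
      rw [norm_zero] at h1
      have h2 := ((h1.mul_const ‖u x‖).sub ((h1.pow 2).const_mul δ)).max
        (tendsto_const_nhds (x := (0 : ℝ)))
      simpa using h2
  rw [integral_zero] at hT
  obtain ⟨N, hN⟩ := Metric.tendsto_atTop.1 hT (ε / 2) (by positivity)
  refine ⟨N, fun n hn => ?_⟩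
  have h1 := hN n hn
  rw [Real.dist_eq, sub_zero, abs_of_nonneg (integral_nonneg fun x => le_max_right _ _)] at h1
  rw [Real.dist_eq, sub_zero, abs_of_nonneg (integral_nonneg fun x => by positivity)]
  have h2 : ∫ x, ‖w n x‖ * ‖u x‖ ∂ν ≤
      ∫ x, (max (‖w n x‖ * ‖u x‖ - δ * ‖w n x‖ ^ 2) 0 + δ * ‖w n x‖ ^ 2) ∂ν := by
    refine integral_mono (hwu n) ((((hwu n).sub ((hw2 n).const_mul δ)).sup
      (integrable_zero _ _ _)).add ((hw2 n).const_mul δ)) fun x => ?_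
    have := le_max_left (‖w n x‖ * ‖u x‖ - δ * ‖w n x‖ ^ 2) 0
    simp only
    linarith
  have h3 : ∫ x, (max (‖w n x‖ * ‖u x‖ - δ * ‖w n x‖ ^ 2) 0 + δ * ‖w n x‖ ^ 2) ∂ν =
      (∫ x, max (‖w n x‖ * ‖u x‖ - δ * ‖w n x‖ ^ 2) 0 ∂ν) + δ * ∫ x, ‖w n x‖ ^ 2 ∂ν := by
    rw [← integral_const_mul]
    exact integral_add (((hwu n).sub ((hw2 n).const_mul δ)).sup
      (integrable_zero _ _ _)) ((hw2 n).const_mul δ)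
  have h4 : δ * ∫ x, ‖w n x‖ ^ 2 ∂ν ≤ δ * C := mul_le_mul_of_nonneg_left (hC n) hδ0.le
  have h5 : δ * C < ε / 2 := by
    rw [hδ, div_mul_eq_mul_div, div_lt_div_iff₀ (by positivity) (by norm_num)]
    nlinarith
  linarith

/-- The elementary inequality behind the Brezis–Lieb lemma. -/
theorem abs_norm_add_rpow_sub_le {q K : ℝ} (hq : 2 ≤ q) {a b : ℂ} (ha : ‖a‖ ≤ K) (hb : ‖b‖ ≤ K) :
    |‖a + b‖ ^ q - ‖a‖ ^ q - ‖b‖ ^ q| ≤ (q * (2 * K) ^ (q - 2) * 2 + K ^ (q - 2)) *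
      (‖a‖ * ‖b‖) := by
  -- With `a` the smaller one, `‖a + b‖` and `‖b‖` both lie in `[0, 2‖b‖]`, so the mean value
  -- theorem for `s ^ q` yields a factor `‖b‖` from the derivative and `‖a‖` from the increment.
  wlog hab : ‖a‖ ≤ ‖b‖ generalizing a b
  · have := this hb ha (le_of_not_ge hab)
    rw [add_comm b a, mul_comm ‖b‖] at this
    rwa [sub_right_comm]
  have hK : 0 ≤ K := (norm_nonneg a).trans ha
  have hpow : ∀ s : ℝ, 0 ≤ s → s ^ q = s ^ (q - 2) * s * s := by
    intro s hs
    rw [mul_assoc, ← sq, ← Real.rpow_natCast s 2, ← Real.rpow_add_of_nonneg hs (by linarith)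
      (by norm_num)]
    norm_num
  have h1 : ‖a‖ ^ q ≤ K ^ (q - 2) * (‖a‖ * ‖b‖) := by
    rw [hpow _ (norm_nonneg a), mul_assoc]
    exact mul_le_mul (Real.rpow_le_rpow (norm_nonneg _) ha (by linarith))
      (mul_le_mul_of_nonneg_left hab (norm_nonneg _)) (by positivity) (by positivity)
  have h2 : |‖a + b‖ ^ q - ‖b‖ ^ q| ≤ (q * (2 * K) ^ (q - 2) * 2) * (‖a‖ * ‖b‖) := by
    have hbd : ∀ s ∈ Icc 0 (2 * ‖b‖), ‖q * s ^ (q - 1)‖ ≤ q * ((2 * K) ^ (q - 2) * (2 * ‖b‖)) := by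
      intro s hs
      rw [Real.norm_eq_abs, abs_of_nonneg (mul_nonneg (by linarith) (Real.rpow_nonneg hs.1 _))]
      refine mul_le_mul_of_nonneg_left ?_ (by linarith)
      have : s ^ (q - 1) = s ^ (q - 2) * s := by
        nth_rewrite 3 [← Real.rpow_one s]
        rw [← Real.rpow_add_of_nonneg hs.1 (by linarith) (by norm_num)]
        ring_nf
      rw [this]
      exact mul_le_mul (Real.rpow_le_rpow hs.1 (by linarith [hs.2]) (by linarith)) hs.2 hs.1
        (by positivity)
    have hm1 : ‖a + b‖ ∈ Icc 0 (2 * ‖b‖) :=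
      ⟨norm_nonneg _, (norm_add_le _ _).trans (by linarith)⟩
    have hm2 : ‖b‖ ∈ Icc 0 (2 * ‖b‖) := ⟨norm_nonneg _, by linarith [norm_nonneg b]⟩
    have := (convex_Icc 0 (2 * ‖b‖)).norm_image_sub_le_of_norm_hasDerivWithin_le
      (f := fun s : ℝ => s ^ q) (f' := fun s => q * s ^ (q - 1))
      (fun s _ => (Real.hasDerivAt_rpow_const (Or.inr (by linarith))).hasDerivWithinAt) hbd hm2 hm1
    rw [Real.norm_eq_abs, Real.norm_eq_abs] at this
    have h3 : |‖a + b‖ - ‖b‖| ≤ ‖a‖ := by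
      simpa using abs_norm_sub_norm_le (a + b) b
    calc _ ≤ _ := this
      _ ≤ q * ((2 * K) ^ (q - 2) * (2 * ‖b‖)) * ‖a‖ :=
        mul_le_mul_of_nonneg_left h3 (by positivity)
      _ = _ := by ring
  calc |‖a + b‖ ^ q - ‖a‖ ^ q - ‖b‖ ^ q| = |(‖a + b‖ ^ q - ‖b‖ ^ q) - ‖a‖ ^ q| := by ring_nf
    _ ≤ |‖a + b‖ ^ q - ‖b‖ ^ q| + |‖a‖ ^ q| := abs_sub _ _
    _ ≤ _ := by
      rw [abs_of_nonneg (Real.rpow_nonneg (norm_nonneg a) q), add_mul]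
      exact add_le_add h2 h1

/-- Bounded functions in `L²` are in `L^q` for `q ≥ 2`. -/
theorem MeasureTheory.MemLp.integrable_norm_rpow_of_bounded {α : Type*} [MeasurableSpace α]
    {ν : Measure α} {u : α → ℂ} {q K : ℝ} (hq : 2 ≤ q) (hu : MemLp u 2 ν)
    (hK : ∀ᵐ x ∂ν, ‖u x‖ ≤ K) :
    Integrable (fun x => ‖u x‖ ^ q) ν ∧
      ∫ x, ‖u x‖ ^ q ∂ν ≤ K ^ (q - 2) * ∫ x, ‖u x‖ ^ 2 ∂ν := by
  have hu2 : Integrable (fun x => ‖u x‖ ^ 2) ν := (memLp_two_iff_integrable_sq_norm hu.1).1 hu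
  have hle : ∀ᵐ x ∂ν, ‖u x‖ ^ q ≤ K ^ (q - 2) * ‖u x‖ ^ 2 := by
    filter_upwards [hK] with x hx
    have : ‖u x‖ ^ q = ‖u x‖ ^ (q - 2) * ‖u x‖ ^ 2 := by
      rw [← Real.rpow_natCast ‖u x‖ 2, ← Real.rpow_add_of_nonneg (norm_nonneg _) (by linarith)
        (by norm_num)]
      norm_num
    rw [this]
    exact mul_le_mul_of_nonneg_right (Real.rpow_le_rpow (norm_nonneg _) hx (by linarith))
      (by positivity)
  have hi : Integrable (fun x => ‖u x‖ ^ q) ν := by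
    refine (hu2.const_mul (K ^ (q - 2))).mono'
      ((hu.1.norm.aemeasurable.pow_const q).aestronglyMeasurable) ?_
    filter_upwards [hle] with x hx
    rwa [Real.norm_eq_abs, abs_of_nonneg (Real.rpow_nonneg (norm_nonneg _) _)]
  refine ⟨hi, ?_⟩
  rw [← integral_const_mul]
  exact integral_mono_ae hi (hu2.const_mul _) hle

/-- The Brezis–Lieb lemma for uniformly bounded functions in `L²`. -/
theorem tendsto_integral_norm_rpow_sub {α : Type*} [MeasurableSpace α] {ν : Measure α}
    {u : ℕ → α → ℂ} {v : α → ℂ} {q K C : ℝ} (hq : 2 ≤ q) (hu : ∀ n, MemLp (u n) 2 ν)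
    (hv : MemLp v 2 ν) (hK : ∀ n, ∀ᵐ x ∂ν, ‖u n x‖ ≤ K) (hvK : ∀ᵐ x ∂ν, ‖v x‖ ≤ K)
    (hC : ∀ n, ∫ x, ‖u n x - v x‖ ^ 2 ∂ν ≤ C)
    (hlim : ∀ᵐ x ∂ν, Tendsto (fun n => u n x) atTop (𝓝 (v x))) :
    Tendsto (fun n => (∫ x, ‖u n x‖ ^ q ∂ν) - ∫ x, ‖u n x - v x‖ ^ q ∂ν) atTop
      (𝓝 (∫ x, ‖v x‖ ^ q ∂ν)) := by
  have hw : ∀ n, MemLp (fun x => u n x - v x) 2 ν := fun n => (hu n).sub hv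
  have hwK : ∀ n, ∀ᵐ x ∂ν, ‖u n x - v x‖ ≤ 2 * K := fun n => by
    filter_upwards [hK n, hvK] with x hx hx'
    exact (norm_sub_le _ _).trans (by linarith)
  have hT := tendsto_integral_norm_mul_norm hw hC hv (by
    filter_upwards [hlim] with x hx
    simpa using hx.sub_const (v x))
  -- The constant of `abs_norm_add_rpow_sub_le` for the bound `2K`, which covers both `u n - v` and
  -- `v`.
  set B := q * (2 * (2 * K)) ^ (q - 2) * 2 + (2 * K) ^ (q - 2)
  have hT2 := hT.const_mul B
  rw [mul_zero] at hT2
  rw [tendsto_iff_dist_tendsto_zero]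
  refine squeeze_zero (fun n => dist_nonneg) (fun n => ?_) hT2
  have i1 := ((hu n).integrable_norm_rpow_of_bounded hq (hK n)).1
  have i2 := ((hw n).integrable_norm_rpow_of_bounded hq (hwK n)).1
  have i3 := (hv.integrable_norm_rpow_of_bounded hq hvK).1
  have i12 : Integrable (fun x => ‖u n x‖ ^ q - ‖u n x - v x‖ ^ q) ν := i1.sub i2
  rw [Real.dist_eq, ← integral_sub i1 i2, ← integral_sub i12 i3, ← integral_const_mul]
  refine (abs_integral_le_integral_abs).trans ?_
  refine integral_mono_ae ((i1.sub i2).sub i3).abs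
    (((hw n).norm.integrable_mul hv.norm).const_mul B) ?_
  filter_upwards [hwK n, hvK] with x hx hx'
  have := abs_norm_add_rpow_sub_le hq hx (hx'.trans (by linarith [(norm_nonneg _).trans hx'] : K ≤ 2 * K))
  simpa using this

/-- The analogue of the Brezis–Lieb lemma for weak convergence in `L²`. -/
theorem tendsto_integral_norm_sq_sub {α : Type*} [MeasurableSpace α] {ν : Measure α}
    {g : ℕ → α → ℂ} {h : α → ℂ} (hg : ∀ n, MemLp (g n) 2 ν) (hh : MemLp h 2 ν)
    (hlim : Tendsto (fun n => ∫ x, inner ℂ (g n x) (h x) ∂ν) atTop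
      (𝓝 (∫ x, inner ℂ (h x) (h x) ∂ν))) :
    Tendsto (fun n => (∫ x, ‖g n x‖ ^ 2 ∂ν) - ∫ x, ‖g n x - h x‖ ^ 2 ∂ν) atTop
      (𝓝 (∫ x, ‖h x‖ ^ 2 ∂ν)) := by
  have i1 : ∀ {f : α → ℂ}, MemLp f 2 ν → Integrable (fun x => ‖f x‖ ^ 2) ν := fun hf =>
    (memLp_two_iff_integrable_sq_norm hf.1).1 hf
  have ii : ∀ {f k : α → ℂ}, MemLp f 2 ν → MemLp k 2 ν →
      Integrable (fun x => (inner ℂ (f x) (k x) : ℂ)) ν := fun hf hk =>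
    (hf.integrable_inner_complex hk)
  -- The difference of squares is affine in `g n`, so weak convergence is enough.
  have hre : ∀ n, (∫ x, ‖g n x‖ ^ 2 ∂ν) - ∫ x, ‖g n x - h x‖ ^ 2 ∂ν =
      2 * (∫ x, inner ℂ (g n x) (h x) ∂ν : ℂ).re - ∫ x, ‖h x‖ ^ 2 ∂ν := by
    intro n
    have hr : (∫ x, inner ℂ (g n x) (h x) ∂ν : ℂ).re = ∫ x, (inner ℂ (g n x) (h x) : ℂ).re ∂ν :=
      (integral_re (ii (hg n) hh)).symm
    have i2 : Integrable (fun x => ‖g n x - h x‖ ^ 2) ν := i1 ((hg n).sub hh)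
    have i3 : Integrable (fun x => 2 * (inner ℂ (g n x) (h x) : ℂ).re) ν :=
      (ii (hg n) hh).re.const_mul 2
    rw [hr, ← integral_sub (i1 (hg n)) i2, ← integral_const_mul, ← integral_sub i3 (i1 hh)]
    refine integral_congr_ae (ae_of_all _ fun x => ?_)
    have := norm_sub_sq (𝕜 := ℂ) (g n x) (h x)
    simp only [RCLike.re_to_complex] at this
    simp only
    linarith
  simp_rw [hre]
  have hr : (∫ x, inner ℂ (h x) (h x) ∂ν : ℂ).re = ∫ x, ‖h x‖ ^ 2 ∂ν := by
    have : (∫ x, inner ℂ (h x) (h x) ∂ν : ℂ).re = ∫ x, (inner ℂ (h x) (h x) : ℂ).re ∂ν :=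
      (integral_re (ii hh hh)).symm
    rw [this]
    refine integral_congr_ae (ae_of_all _ fun x => ?_)
    exact (norm_sq_eq_re_inner (𝕜 := ℂ) (h x)).symm
  have h1 := ((Complex.continuous_re.tendsto _).comp hlim).const_mul 2 |>.sub_const
    (∫ x, ‖h x‖ ^ 2 ∂ν)
  rw [hr] at h1
  have h2 : 2 * (∫ x, ‖h x‖ ^ 2 ∂ν) - ∫ x, ‖h x‖ ^ 2 ∂ν = ∫ x, ‖h x‖ ^ 2 ∂ν := by ring
  rw [h2] at h1
  exact h1

/-! ### The soliton -/

/-- The moments of the hyperbolic secant. -/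
noncomputable def sechMoment (β : ℝ) : ℝ := ∫ x, (Real.cosh x)⁻¹ ^ β

theorem continuous_inv_cosh_rpow (β : ℝ) : Continuous fun x : ℝ => (Real.cosh x)⁻¹ ^ β :=
  (Real.continuous_cosh.inv₀ fun x => (Real.cosh_pos x).ne').rpow_const fun x =>
    Or.inl (inv_pos.2 (Real.cosh_pos x)).ne'

theorem inv_cosh_rpow_le (β : ℝ) (hβ : 0 < β) (x : ℝ) :
    (Real.cosh x)⁻¹ ^ β ≤ 2 ^ β * Real.exp (-β * |x|) := by
  have h1 : (Real.cosh x)⁻¹ ≤ 2 * Real.exp (-|x|) := by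
    rw [← Real.cosh_abs, Real.exp_neg, inv_le_comm₀ (Real.cosh_pos _) (by positivity),
      mul_inv, inv_inv, Real.cosh_eq]
    have := Real.exp_pos (-|x|)
    linarith
  calc (Real.cosh x)⁻¹ ^ β ≤ (2 * Real.exp (-|x|)) ^ β :=
        Real.rpow_le_rpow (inv_pos.2 (Real.cosh_pos x)).le h1 hβ.le
    _ = 2 ^ β * Real.exp (-β * |x|) := by
        rw [Real.mul_rpow (by norm_num) (Real.exp_pos _).le, ← Real.exp_mul]
        ring_nf

theorem integrable_exp_neg_mul_abs {β : ℝ} (hβ : 0 < β) :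
    Integrable fun x : ℝ => Real.exp (-β * |x|) := by
  -- The integral of a non-integrable function is 0 by convention, so a nonzero value proves
  -- integrability.
  refine (not_imp_comm.1 integral_undef) (ne_of_gt ?_)
  rw [integral_comp_abs (f := fun x => Real.exp (-β * x)), integral_exp_mul_Ioi (by linarith)]
  simp only [mul_zero, Real.exp_zero]
  rw [neg_div_neg_eq]
  positivity

theorem integrable_inv_cosh_rpow {β : ℝ} (hβ : 0 < β) :
    Integrable fun x : ℝ => (Real.cosh x)⁻¹ ^ β := by
  refine ((integrable_exp_neg_mul_abs hβ).const_mul (2 ^ β)).mono'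
    (continuous_inv_cosh_rpow β).aestronglyMeasurable (ae_of_all _ fun x => ?_)
  rw [Real.norm_eq_abs, abs_of_nonneg (Real.rpow_nonneg (inv_pos.2 (Real.cosh_pos x)).le _)]
  exact inv_cosh_rpow_le β hβ x

theorem tendsto_inv_cosh_rpow_atTop {β : ℝ} (hβ : 0 < β) :
    Tendsto (fun x : ℝ => (Real.cosh x)⁻¹ ^ β) atTop (𝓝 0) := by
  have h : Tendsto Real.cosh atTop atTop := by
    refine tendsto_atTop_mono (fun x => ?_) (Real.tendsto_exp_atTop.atTop_div_const (r := 2) two_pos)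
    rw [Real.cosh_eq]
    have := Real.exp_pos (-x)
    linarith
  have := h.inv_tendsto_atTop.rpow_const (p := β) (Or.inr hβ.le)
  rwa [Real.zero_rpow hβ.ne'] at this

theorem sechMoment_pos {β : ℝ} (hβ : 0 < β) : 0 < sechMoment β :=
  integral_pos_of_integrable_nonneg_nonzero (x := 0) (continuous_inv_cosh_rpow β)
    (integrable_inv_cosh_rpow hβ)
    (fun x => Real.rpow_nonneg (inv_pos.2 (Real.cosh_pos x)).le _) (by simp)

theorem hasDerivAt_inv_cosh_rpow (β x : ℝ) :
    HasDerivAt (fun x : ℝ => (Real.cosh x)⁻¹ ^ β)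
      (-β * (Real.cosh x)⁻¹ ^ β * (Real.sinh x * (Real.cosh x)⁻¹)) x := by
  have hc := Real.cosh_pos x
  have h1 : HasDerivAt (fun x : ℝ => (Real.cosh x)⁻¹) (-Real.sinh x / Real.cosh x ^ 2) x :=
    (Real.hasDerivAt_cosh x).inv hc.ne'
  have h2 := h1.rpow_const (p := β) (Or.inl (inv_pos.2 hc).ne')
  convert h2 using 1
  rw [Real.rpow_sub_one (inv_pos.2 hc).ne']
  field_simp

theorem inv_cosh_rpow_add_two (β x : ℝ) :
    (Real.cosh x)⁻¹ ^ (β + 2) = (Real.cosh x)⁻¹ ^ β * (Real.cosh x)⁻¹ ^ 2 := by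
  rw [Real.rpow_add (inv_pos.2 (Real.cosh_pos x))]
  norm_num

theorem tanh_sq_eq (x : ℝ) : (Real.sinh x * (Real.cosh x)⁻¹) ^ 2 = 1 - (Real.cosh x)⁻¹ ^ 2 := by
  have := Real.cosh_sq x
  have hc := Real.cosh_pos x
  field_simp
  linarith

/-- The derivative of `sech^β tanh` is `(β+1) sech^(β+2) - β sech^β`, and `sech^β tanh` vanishes at
both infinities. This reduces the mass and both parts of the soliton energy to a single moment. -/
theorem sechMoment_add_two {β : ℝ} (hβ : 0 < β) :
    sechMoment (β + 2) = β / (β + 1) * sechMoment β := by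
  have hd : ∀ x : ℝ, HasDerivAt (fun x : ℝ => (Real.cosh x)⁻¹ ^ β * (Real.sinh x * (Real.cosh x)⁻¹))
      ((β + 1) * (Real.cosh x)⁻¹ ^ (β + 2) - β * (Real.cosh x)⁻¹ ^ β) x := by
    intro x
    have hc := Real.cosh_pos x
    have h1 : HasDerivAt (fun x : ℝ => Real.sinh x * (Real.cosh x)⁻¹)
        (Real.cosh x * (Real.cosh x)⁻¹ + Real.sinh x * (-Real.sinh x / Real.cosh x ^ 2)) x :=
      (Real.hasDerivAt_sinh x).mul ((Real.hasDerivAt_cosh x).inv hc.ne')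
    refine ((hasDerivAt_inv_cosh_rpow β x).mul h1).congr_deriv ?_
    rw [inv_cosh_rpow_add_two]
    have := Real.sinh_sq x
    field_simp
    rw [this]
    ring
  have habs : ∀ x : ℝ, |Real.sinh x * (Real.cosh x)⁻¹| ≤ 1 := by
    intro x
    rw [abs_le_one_iff_mul_self_le_one, ← sq, tanh_sq_eq]
    have := sq_nonneg (Real.cosh x)⁻¹
    linarith
  have hint : Integrable fun x : ℝ =>
      (β + 1) * (Real.cosh x)⁻¹ ^ (β + 2) - β * (Real.cosh x)⁻¹ ^ β :=
    ((integrable_inv_cosh_rpow (by linarith)).const_mul _).sub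
      ((integrable_inv_cosh_rpow hβ).const_mul _)
  have hbd : ∀ x : ℝ, ‖(Real.cosh x)⁻¹ ^ β * (Real.sinh x * (Real.cosh x)⁻¹)‖
      ≤ (Real.cosh x)⁻¹ ^ β := by
    intro x
    have h0 : 0 ≤ (Real.cosh x)⁻¹ ^ β := Real.rpow_nonneg (inv_pos.2 (Real.cosh_pos x)).le _
    rw [norm_mul, Real.norm_eq_abs, Real.norm_eq_abs, abs_of_nonneg h0]
    exact mul_le_of_le_one_right h0 (habs x)
  have htop := squeeze_zero_norm hbd (tendsto_inv_cosh_rpow_atTop hβ)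
  have hbot : Tendsto (fun x : ℝ => (Real.cosh x)⁻¹ ^ β * (Real.sinh x * (Real.cosh x)⁻¹)) atBot
      (𝓝 0) := by
    refine squeeze_zero_norm hbd ?_
    have := (tendsto_inv_cosh_rpow_atTop hβ).comp tendsto_neg_atBot_atTop
    simpa [Function.comp_def] using this
  have h := integral_of_hasDerivAt_of_tendsto hd hint hbot htop
  rw [integral_sub ((integrable_inv_cosh_rpow (by linarith)).const_mul _)
      ((integrable_inv_cosh_rpow hβ).const_mul _), integral_const_mul, integral_const_mul,
    sub_self, sub_eq_zero] at h
  change (β + 1) * sechMoment (β + 2) = β * sechMoment β at h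
  have : β + 1 ≠ 0 := by positivity
  field_simp
  linarith

/-! ### The action function and the optimality of the soliton -/

/-- The square root of twice the potential `(M^{p-2} s² - |s|^p) / p`. -/
noncomputable def solitonSpeed (p M s : ℝ) : ℝ :=
  √(2 / p) * (s * √(M ^ (p - 2) - |s| ^ (p - 2)))

/-- The primitive of `solitonSpeed`. -/
noncomputable def solitonAction (p M s : ℝ) : ℝ := ∫ t in (0 : ℝ)..s, solitonSpeed p M t

/-- The real square root is 0 on negative numbers, so the speed is 0 for `|s| ≥ M` when `M ≥ 0`.
Being continuous on all of ℝ, it has a C¹ primitive, as the chain rule estimate requires. -/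
theorem continuous_solitonSpeed {p : ℝ} (hp : 2 < p) (M : ℝ) : Continuous (solitonSpeed p M) := by
  unfold solitonSpeed
  have : Continuous fun s : ℝ => |s| ^ (p - 2) :=
    continuous_abs.rpow_const fun x => Or.inr (by linarith)
  fun_prop

theorem hasDerivAt_solitonAction {p : ℝ} (hp : 2 < p) (M s : ℝ) :
    HasDerivAt (solitonAction p M) (solitonSpeed p M s) s :=
  intervalIntegral.integral_hasDerivAt_right
    ((continuous_solitonSpeed hp M).intervalIntegrable _ _)
    ((continuous_solitonSpeed hp M).stronglyMeasurableAtFilter _ _)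
    (continuous_solitonSpeed hp M).continuousAt

theorem solitonSpeed_nonneg (p M : ℝ) {s : ℝ} (hs : 0 ≤ s) : 0 ≤ solitonSpeed p M s := by
  unfold solitonSpeed; positivity

theorem solitonSpeed_sq {p M s : ℝ} (hp : 2 < p) (hs : 0 ≤ s) (hsM : s ≤ M) :
    solitonSpeed p M s ^ 2 = 2 / p * (M ^ (p - 2) * s ^ 2 - s ^ p) := by
  have h1 : s ^ (p - 2) ≤ M ^ (p - 2) := Real.rpow_le_rpow hs hsM (by linarith)
  have h2 : s ^ p = s ^ (p - 2) * s ^ 2 := by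
    rw [← Real.rpow_natCast s 2, ← Real.rpow_add_of_nonneg hs (by linarith) (by norm_num)]
    norm_num
  unfold solitonSpeed
  rw [abs_of_nonneg hs, mul_pow, mul_pow, Real.sq_sqrt (by positivity),
    Real.sq_sqrt (by linarith), h2]
  ring

/-- Substituting `s = M t` gives one factor `M` from `ds`, one from `s`, and `M^((p-2)/2)` from the
square root. -/
theorem solitonAction_self {p M : ℝ} (hp : 2 < p) (hM : 0 ≤ M) :
    solitonAction p M M = M ^ ((p + 2) / 2) * solitonAction p 1 1 := by
  rcases eq_or_lt_of_le hM with rfl | hM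
  · simp [solitonAction, Real.zero_rpow (by linarith : (p + 2) / 2 ≠ 0)]
  have h1 := intervalIntegral.smul_integral_comp_mul_left (a := 0) (b := 1)
    (solitonSpeed p M) M
  rw [mul_zero, mul_one] at h1
  unfold solitonAction
  rw [← h1, smul_eq_mul, ← intervalIntegral.integral_const_mul,
    ← intervalIntegral.integral_const_mul]
  refine intervalIntegral.integral_congr fun t ht => ?_
  rw [uIcc_of_le zero_le_one] at ht
  simp only [solitonSpeed]
  rw [abs_mul, abs_of_pos hM, abs_of_nonneg ht.1, Real.mul_rpow hM.le ht.1, Real.one_rpow]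
  have h2 : M ^ (p - 2) - M ^ (p - 2) * t ^ (p - 2) = M ^ (p - 2) * (1 - t ^ (p - 2)) := by ring
  have h3 : √(M ^ (p - 2)) = M ^ ((p - 2) / 2) := by
    rw [Real.sqrt_eq_rpow, ← Real.rpow_mul hM.le]
    ring_nf
  have h4 : M ^ ((p + 2) / 2) = M * (M * M ^ ((p - 2) / 2)) := by
    nth_rewrite 2 [← Real.rpow_one M]
    nth_rewrite 3 [← Real.rpow_one M]
    rw [← Real.rpow_add hM, ← Real.rpow_add hM]
    ring_nf
  rw [h2, Real.sqrt_mul (by positivity), h3, h4]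
  ring

/-- Substitute the soliton profile `s = sech^α x` with `α = 2/(p-2)`: then `s^(p-2) = sech²`, the
square root becomes `tanh`, and the action is an integral of powers of `sech` over the half line. -/
theorem two_mul_solitonAction_one {p : ℝ} (hp : 2 < p) :
    2 * solitonAction p 1 1 =
      √(2 / p) * (2 / (p - 2)) * (sechMoment (4 / (p - 2)) / (4 / (p - 2) + 1)) := by
  have hp0 : 0 < p - 2 := by linarith
  set α := 2 / (p - 2) with hα
  have hα0 : 0 < α := by positivity
  have h4 : 4 / (p - 2) = 2 * α := by rw [hα]; ring
  rw [h4]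
  let q : ℝ → ℝ := fun x => (Real.cosh x)⁻¹ ^ (2 * α) - (Real.cosh x)⁻¹ ^ (2 * α + 2)
  have hqi : Integrable q := (integrable_inv_cosh_rpow (by linarith)).sub
    (integrable_inv_cosh_rpow (by linarith))
  have hder : ∀ x ∈ Ici (0 : ℝ), HasDerivAt
      (fun x => solitonAction p 1 ((Real.cosh x)⁻¹ ^ α)) (-(√(2 / p) * α) * q x) x := by
    intro x hx
    have hc := Real.cosh_pos x
    have hS : 0 < (Real.cosh x)⁻¹ ^ α := Real.rpow_pos_of_pos (inv_pos.2 hc) _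
    refine ((hasDerivAt_solitonAction hp 1 _).comp x (hasDerivAt_inv_cosh_rpow α x)).congr_deriv ?_
    have h1 : |(Real.cosh x)⁻¹ ^ α| ^ (p - 2) = (Real.cosh x)⁻¹ ^ 2 := by
      rw [abs_of_pos hS, ← Real.rpow_mul (inv_pos.2 hc).le, hα, div_mul_cancel₀ _ hp0.ne']
      norm_num
    have hth : 0 ≤ Real.sinh x * (Real.cosh x)⁻¹ :=
      mul_nonneg (Real.sinh_nonneg_iff.2 hx) (inv_pos.2 hc).le
    have h2 : (Real.cosh x)⁻¹ ^ (2 * α) = (Real.cosh x)⁻¹ ^ α * (Real.cosh x)⁻¹ ^ α := by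
      rw [← Real.rpow_add (inv_pos.2 hc)]; ring_nf
    simp only [q, solitonSpeed]
    rw [h1, Real.one_rpow, ← tanh_sq_eq, Real.sqrt_sq hth, inv_cosh_rpow_add_two, h2]
    have h3 := tanh_sq_eq x
    linear_combination -(√(2 / p) * α * ((Real.cosh x)⁻¹ ^ α * (Real.cosh x)⁻¹ ^ α)) * h3
  have hlim : Tendsto (fun x => solitonAction p 1 ((Real.cosh x)⁻¹ ^ α)) atTop (𝓝 0) := by
    have h1 := (hasDerivAt_solitonAction hp 1 0).continuousAt.tendsto.comp
      (tendsto_inv_cosh_rpow_atTop hα0)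
    have h0 : solitonAction p 1 0 = 0 := by simp [solitonAction]
    rwa [h0] at h1
  have h5 := integral_Ioi_of_hasDerivAt_of_tendsto' hder
    ((hqi.const_mul _).integrableOn) hlim
  simp only [Real.cosh_zero, inv_one, Real.one_rpow, zero_sub] at h5
  rw [integral_const_mul] at h5
  have h6 : ∫ x, q x = 2 * ∫ x in Ioi (0 : ℝ), q x := by
    rw [← integral_comp_abs]
    simp [q, Real.cosh_abs]
  have h7 : ∫ x, q x = sechMoment (2 * α) - sechMoment (2 * α + 2) :=
    integral_sub (integrable_inv_cosh_rpow (by linarith)) (integrable_inv_cosh_rpow (by linarith))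
  rw [sechMoment_add_two (by linarith)] at h7
  have h8 : sechMoment (2 * α) - 2 * α / (2 * α + 1) * sechMoment (2 * α) =
    sechMoment (2 * α) / (2 * α + 1) := by
    field_simp
    ring
  rw [h8] at h7
  rw [← h7, h6]
  linarith

theorem integral_inv_cosh_mul_rpow (β : ℝ) {l : ℝ} (hl : 0 < l) :
    ∫ x, (Real.cosh (l * x))⁻¹ ^ β = l⁻¹ * sechMoment β := by
  rw [Measure.integral_comp_mul_left (fun x => (Real.cosh x)⁻¹ ^ β) l, abs_of_pos (inv_pos.2 hl),
    smul_eq_mul, sechMoment]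

/-- The energy of a rescaled power of the hyperbolic secant. -/
theorem lineEnergy_inv_cosh_rpow {p A l : ℝ} (hp : 2 < p) (hA : 0 < A) (hl : 0 < l) :
    lineEnergy p (fun x => A * (Real.cosh (l * x))⁻¹ ^ (2 / (p - 2))) =
      1 / 2 * (A ^ 2 * (2 / (p - 2)) ^ 2 * l * (sechMoment (4 / (p - 2)) / (4 / (p - 2) + 1)))
      - 1 / p * (A ^ p * l⁻¹ *
        (4 / (p - 2) / (4 / (p - 2) + 1) * sechMoment (4 / (p - 2)))) := by
  have hp0 : 0 < p - 2 := by linarith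
  set α := 2 / (p - 2) with hα
  have hα0 : 0 < α := by positivity
  have h4 : 4 / (p - 2) = 2 * α := by rw [hα]; ring
  rw [h4]
  have hcp : ∀ x, 0 < (Real.cosh x)⁻¹ := fun x => inv_pos.2 (Real.cosh_pos x)
  have hderiv : ∀ x, deriv (fun x => A * (Real.cosh (l * x))⁻¹ ^ α) x ^ 2 =
      A ^ 2 * α ^ 2 * l ^ 2 * ((Real.cosh (l * x))⁻¹ ^ (2 * α)
        - (Real.cosh (l * x))⁻¹ ^ (2 * α + 2)) := by
    intro x
    have h1 : HasDerivAt (fun x : ℝ => l * x) l x := by simpa using (hasDerivAt_id x).const_mul l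
    have h2 := (((hasDerivAt_inv_cosh_rpow α (l * x)).comp x h1).const_mul A)
    have h3 : deriv (fun x => A * (Real.cosh (l * x))⁻¹ ^ α) x = _ := h2.deriv
    have h5 : (Real.cosh (l * x))⁻¹ ^ (2 * α) = ((Real.cosh (l * x))⁻¹ ^ α) ^ 2 := by
      rw [two_mul, Real.rpow_add (hcp _), sq]
    rw [h3, inv_cosh_rpow_add_two, h5]
    have h6 := tanh_sq_eq (l * x)
    linear_combination (A ^ 2 * α ^ 2 * l ^ 2 * ((Real.cosh (l * x))⁻¹ ^ α) ^ 2) * h6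
  have hpow : ∀ x, |A * (Real.cosh (l * x))⁻¹ ^ α| ^ p =
      A ^ p * (Real.cosh (l * x))⁻¹ ^ (2 * α + 2) := by
    intro x
    have : α * p = 2 * α + 2 := by rw [hα]; field_simp; ring
    rw [abs_of_pos (mul_pos hA (Real.rpow_pos_of_pos (hcp _) _)),
      Real.mul_rpow hA.le (Real.rpow_nonneg (hcp _).le _), ← Real.rpow_mul (hcp _).le, this]
  have hi : ∀ β : ℝ, 0 < β → Integrable fun x => (Real.cosh (l * x))⁻¹ ^ β := fun β hβ =>
    (integrable_comp_mul_left_iff (fun x => (Real.cosh x)⁻¹ ^ β) hl.ne').2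
      (integrable_inv_cosh_rpow hβ)
  unfold lineEnergy
  simp_rw [hderiv, hpow]
  rw [integral_const_mul, integral_const_mul, integral_sub (hi _ (by linarith))
    (hi _ (by linarith)), integral_inv_cosh_mul_rpow _ hl, integral_inv_cosh_mul_rpow _ hl,
    sechMoment_add_two (by linarith)]
  field_simp
  ring

/-- The amplitude and the width of the soliton are related by its equation and its mass. -/
theorem soliton_parameters {p μ : ℝ} (hp2 : 2 < p) (hp6 : p < 6) (hμ : 0 < μ) :
    ∃ A l : ℝ, 0 < A ∧ 0 < l ∧
      soliton p μ = (fun x => A * (Real.cosh (l * x))⁻¹ ^ (2 / (p - 2))) ∧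
      A ^ (p - 2) = p / 2 * (2 / (p - 2) * l) ^ 2 ∧
      A ^ 2 * sechMoment (4 / (p - 2)) = μ * l := by
  have hb : 0 < p - 2 := by linarith
  have h6 : 0 < 6 - p := by linarith
  set J := sechMoment (4 / (p - 2)) with hJ
  have hJ0 : 0 < J := sechMoment_pos (by positivity)
  set B := 2 * p / (p - 2) ^ 2 with hB
  have hB0 : 0 < B := by positivity
  set c := solitonWidth p with hc
  have hcdef : c = (B ^ (2 / (p - 2)) * J) ^ (-((p - 2) / (6 - p))) := rfl
  have hK : 0 < B ^ (2 / (p - 2)) * J := by positivity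
  have hc0 : 0 < c := by rw [hcdef]; positivity
  set C := solitonHeight p with hC
  have hCdef : C = (B * c ^ 2) ^ (1 / (p - 2)) := rfl
  have hC0 : 0 < C := by rw [hCdef]; positivity
  refine ⟨C * μ ^ (2 / (6 - p)), c * μ ^ ((p - 2) / (6 - p)), by positivity, by positivity,
    rfl, ?_, ?_⟩
  -- This relation is the soliton equation: the terms in `sech^(α+2)` balance when `A^(p-2) = α(α+1)
  -- l²`, where `α = 2/(p-2)` and `α + 1 = pα/2`.
  · have h1 : C ^ (p - 2) = B * c ^ 2 := by
      rw [hCdef, ← Real.rpow_mul (by positivity), one_div_mul_cancel hb.ne', Real.rpow_one]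
    have h2 : (μ ^ (2 / (6 - p))) ^ (p - 2) = (μ ^ ((p - 2) / (6 - p))) ^ 2 := by
      rw [← Real.rpow_natCast, ← Real.rpow_mul hμ.le, ← Real.rpow_mul hμ.le]
      congr 1
      push_cast
      ring
    rw [Real.mul_rpow hC0.le (by positivity), h1, h2, hB]
    field_simp
  -- This relation is the mass `A² J / l = μ`. The exponent in `solitonWidth` is the reciprocal of
  -- `-(4/(p-2) - 1) = -(6-p)/(p-2)`, which makes the moment cancel.
  · have h1 : C ^ 2 = B ^ (2 / (p - 2)) * c ^ (4 / (p - 2)) := by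
      rw [hCdef, ← Real.rpow_natCast, ← Real.rpow_mul (by positivity),
        Real.mul_rpow hB0.le (by positivity), ← Real.rpow_natCast c 2, ← Real.rpow_mul hc0.le]
      congr 2 <;> push_cast <;> ring
    have h2 : c ^ (4 / (p - 2)) = c * (B ^ (2 / (p - 2)) * J)⁻¹ := by
      have h3 : 4 / (p - 2) = 1 + (6 - p) / (p - 2) := by field_simp; ring
      have h4 : c ^ ((6 - p) / (p - 2)) = (B ^ (2 / (p - 2)) * J)⁻¹ := by
        rw [hcdef, ← Real.rpow_mul hK.le, ← Real.rpow_neg_one]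
        congr 1
        field_simp
      rw [h3, Real.rpow_add hc0, Real.rpow_one, h4]
    have h5 : (μ ^ (2 / (6 - p))) ^ 2 = μ * μ ^ ((p - 2) / (6 - p)) := by
      nth_rewrite 2 [← Real.rpow_one μ]
      rw [← Real.rpow_natCast, ← Real.rpow_mul hμ.le, ← Real.rpow_add hμ]
      congr 1
      push_cast
      field_simp
      ring
    rw [mul_pow, h1, h2, h5]
    field_simp

/-- Optimality of the soliton among all amplitudes `M`. -/
theorem lineEnergy_soliton_le {p μ M : ℝ} (hp2 : 2 < p) (hp6 : p < 6) (hμ : 0 < μ) (hM : 0 ≤ M) :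
    lineEnergy p (soliton p μ) ≤ 2 * solitonAction p M M - μ / p * M ^ (p - 2) := by
  obtain ⟨A, l, hA, hl, hsol, hAl, hmass⟩ := soliton_parameters hp2 hp6 hμ
  have hb : 0 < p - 2 := by linarith
  have hp : 0 < p := by linarith
  set J := sechMoment (4 / (p - 2)) with hJ
  set X := A ^ (p - 2) with hX
  have hX0 : 0 < X := by positivity
  have hAp : A ^ p = A ^ 2 * X := by
    rw [hX, ← Real.rpow_natCast A 2, ← Real.rpow_add hA]
    congr 1
    push_cast
    ring
  have hE : lineEnergy p (soliton p μ) = μ / p * X * (2 * (p - 2) / (p + 2) - 1) := by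
    rw [hsol, lineEnergy_inv_cosh_rpow hp2 hA hl, hAp, ← hJ]
    have hJ' : J = μ * l / A ^ 2 := by field_simp; linarith
    have e1 : 1 / 2 * (A ^ 2 * (2 / (p - 2)) ^ 2 * l * (J / (4 / (p - 2) + 1))) =
        1 / p * μ * X / (4 / (p - 2) + 1) := by
      rw [hJ', hAl]
      field_simp
    rw [e1, hJ']
    have : 4 / (p - 2) + 1 = (p + 2) / (p - 2) := by field_simp; ring
    rw [this]
    field_simp
    ring
  have hY : √X = √(p / 2) * (2 / (p - 2) * l) := by
    rw [hAl, Real.sqrt_mul (by positivity), Real.sqrt_sq (by positivity)]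
  have hκ : 2 * solitonAction p 1 1 = μ / p * (2 * (p - 2) / (p + 2)) * (√X / A ^ 2) := by
    rw [two_mul_solitonAction_one hp2, ← hJ]
    have hJ' : J = μ * l / A ^ 2 := by field_simp; linarith
    have h2 : √(2 / p) = 2 / p * √(p / 2) := by
      rw [← inv_div, Real.sqrt_inv]
      have : √(p / 2) * √(p / 2) = p / 2 := Real.mul_self_sqrt (by positivity)
      have h0 : √(p / 2) ≠ 0 := by positivity
      field_simp
      linarith
    have : 4 / (p - 2) + 1 = (p + 2) / (p - 2) := by field_simp; ring
    rw [hY, hJ', h2, this]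
    field_simp
  set t := M / A with ht
  have ht0 : 0 ≤ t := by positivity
  have hMt : M = A * t := by rw [ht]; field_simp
  -- In units of `μ X / p` the claim is this inequality in `t = M / A`. It is Bernoulli's for the
  -- exponent `2(p-2)/(p+2)`, which is at most 1 because `p < 6`; equality at `t = 1` is the height
  -- of the soliton.
  have hbern : t ^ (p - 2) ≤ 1 + 2 * (p - 2) / (p + 2) * (t ^ ((p + 2) / 2) - 1) := by
    have h := rpow_one_add_le_one_add_mul_self (s := t ^ ((p + 2) / 2) - 1)
      (by linarith [Real.rpow_nonneg ht0 ((p + 2) / 2)]) (p := 2 * (p - 2) / (p + 2))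
      (by positivity) (by rw [div_le_one (by positivity)]; linarith)
    rw [add_sub_cancel, ← Real.rpow_mul ht0] at h
    have : (p + 2) / 2 * (2 * (p - 2) / (p + 2)) = p - 2 := by field_simp
    rwa [this] at h
  have hpowA : A ^ ((p + 2) / 2) = A ^ 2 * √X := by
    rw [hX, Real.sqrt_eq_rpow, ← Real.rpow_mul hA.le, ← Real.rpow_natCast A 2, ← Real.rpow_add hA]
    congr 1
    push_cast
    ring
  have hXX : √X * √X = X := Real.mul_self_sqrt hX0.le
  have h1 : 2 * solitonAction p M M =
      μ / p * X * (2 * (p - 2) / (p + 2) * t ^ ((p + 2) / 2)) := by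
    rw [solitonAction_self hp2 hM]
    calc 2 * (M ^ ((p + 2) / 2) * solitonAction p 1 1)
        = M ^ ((p + 2) / 2) * (2 * solitonAction p 1 1) := by ring
      _ = _ := by
        rw [hκ, hMt, Real.mul_rpow hA.le ht0, hpowA]
        nth_rewrite 3 [← hXX]
        field_simp
  have h2 : M ^ (p - 2) = X * t ^ (p - 2) := by rw [hMt, Real.mul_rpow hA.le ht0]
  rw [hE, h1, h2]
  have h3 : 0 ≤ μ / p * X := by positivity
  have h4 := mul_le_mul_of_nonneg_left hbern h3
  linarith

/-! ### Weak derivatives and primitives -/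

/-- A smooth function of integral zero supported in `[a, b]` is the derivative of a test function
supported in `[a, b]`. -/
theorem exists_contDiff_deriv_eq {η : ℝ → ℝ} (hη : ContDiff ℝ ∞ η) {a b : ℝ}
    (hs : ∀ x, x ∉ Icc a b → η x = 0) (h0 : ∫ x, η x = 0) :
    ∃ φ : ℝ → ℝ, ContDiff ℝ ∞ φ ∧ HasCompactSupport φ ∧ tsupport φ ⊆ Icc a b ∧ deriv φ = η := by
  -- A base point strictly left of `a` makes the integrand vanish throughout the range when `x < a`,
  -- and puts the whole support in `(a - 1, x]` when `x > b`.
  let φ : ℝ → ℝ := fun x => ∫ t in (a - 1)..x, η t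
  have hc := hη.continuous
  have hd : deriv φ = η := by
    funext x
    exact hc.deriv_integral _ _ _
  have hφ : ∀ x, x ∉ Icc a b → φ x = 0 := by
    intro x hx
    rw [mem_Icc, not_and_or, not_le, not_le] at hx
    rcases hx with hx | hx
    · refine (intervalIntegral.integral_congr (g := fun _ => (0 : ℝ)) fun t ht => ?_).trans (by simp)
      refine hs t fun ht' => ?_
      have := ht.2.trans_lt (max_lt (by linarith) hx)
      exact absurd ht'.1 (not_le.2 this)
    · have : φ x = ∫ t, η t := by
        refine intervalIntegral.integral_eq_integral_of_support_subset fun t ht => ?_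
        have : t ∈ Icc a b := by
          by_contra h
          exact ht (hs t h)
        exact ⟨by linarith [this.1], this.2.trans hx.le⟩
      rw [this, h0]
  have hts : tsupport φ ⊆ Icc a b := closure_minimal (fun x hx => by
    by_contra h
    exact hx (hφ x h)) isClosed_Icc
  refine ⟨φ, ?_, isCompact_Icc.of_isClosed_subset (isClosed_tsupport φ) hts, hts, hd⟩
  rw [contDiff_infty_iff_deriv]
  refine ⟨fun x => ?_, by rwa [hd]⟩
  exact (intervalIntegral.integral_hasDerivAt_right (hc.intervalIntegrable _ _)
    (hc.stronglyMeasurableAtFilter _ _) hc.continuousAt).differentiableAt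

/-- The lemma of du Bois-Reymond. -/
theorem eqOn_const_of_integral_deriv_smul_eq_zero {U : Set ℝ} (hU : IsOpen U)
    (hUc : U.OrdConnected) {f : ℝ → ℂ} (hf : ContinuousOn f U)
    (h : ∀ φ : ℝ → ℝ, ContDiff ℝ ∞ φ → HasCompactSupport φ → tsupport φ ⊆ U →
      ∫ x in U, deriv φ x • f x = 0) :
    ∃ c, ∀ x ∈ U, f x = c := by
  rcases U.eq_empty_or_nonempty with rfl | ⟨x₀, hx₀⟩
  · exact ⟨0, by simp⟩
  obtain ⟨r, hr, hrU⟩ := Metric.isOpen_iff.1 hU x₀ hx₀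
  let ψ : ContDiffBump x₀ := ⟨r / 4, r / 2, by positivity, by linarith⟩
  let ψ₀ : ℝ → ℝ := ψ.normed volume
  have hψ₀ : ContDiff ℝ ∞ ψ₀ := ψ.contDiff_normed
  have hψ₀c : HasCompactSupport ψ₀ := ψ.hasCompactSupport_normed
  have hψ₀U : tsupport ψ₀ ⊆ U := by
    rw [ψ.tsupport_normed_eq]
    exact (Metric.closedBall_subset_ball (by show r / 2 < r; linarith)).trans hrU
  have hψ₀1 : ∫ x, ψ₀ x = 1 := ψ.integral_normed
  have hi : ∀ w : ℝ → ℂ, ContinuousOn w U → ∀ φ : ℝ → ℝ, ContDiff ℝ ∞ φ →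
      HasCompactSupport φ → tsupport φ ⊆ U →
      IntegrableOn (fun x => φ x • w x) U ∧ ∫ x, φ x • w x = ∫ x in U, φ x • w x := by
    intro w hw φ hφ hc hs
    have h0 : ∀ x, x ∉ tsupport φ → φ x • w x = 0 := fun x hx => by
      rw [image_eq_zero_of_notMem_tsupport hx, zero_smul]
    refine ⟨?_, (setIntegral_eq_integral_of_forall_compl_eq_zero
      fun x hx => h0 x fun hx' => hx (hs hx')).symm⟩
    have h2 : IntegrableOn (fun x => φ x • w x) (tsupport φ) :=
      (hφ.continuous.continuousOn.smul (hw.mono hs)).integrableOn_compact hc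
    exact ((integrableOn_iff_integrable_of_support_subset fun x hx => by
      by_contra hx'
      exact hx (h0 x hx')).1 h2).integrableOn
  set c : ℂ := ∫ x in U, ψ₀ x • f x with hc
  refine ⟨c, ?_⟩
  have hae := hU.ae_eq_zero_of_integral_contDiff_smul_eq_zero (μ := volume) (f := fun x => f x - c)
    ((hf.sub continuousOn_const).locallyIntegrableOn hU.measurableSet) (fun φ hφ hφc hφU => by
      -- Subtracting `m ψ₀` leaves integral zero, so the difference is the derivative of a test
      -- function. Order-connectedness keeps the hull `[a, b]` of the two supports inside `U`. The
      -- constant `c` is thus the `ψ₀`-mean of `f`.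
      set m := ∫ x, φ x with hm
      have hK : IsCompact (tsupport φ ∪ tsupport ψ₀) := IsCompact.union hφc hψ₀c
      have hKne : (tsupport φ ∪ tsupport ψ₀).Nonempty := by
        refine Nonempty.inr ?_
        rw [ψ.tsupport_normed_eq]
        exact ⟨x₀, Metric.mem_closedBall_self ψ.rOut_pos.le⟩
      obtain ⟨a, ha⟩ := hK.exists_isLeast hKne
      obtain ⟨b, hb⟩ := hK.exists_isGreatest hKne
      have hKU : tsupport φ ∪ tsupport ψ₀ ⊆ U := union_subset hφU hψ₀U
      have hab : Icc a b ⊆ U := hUc.out (hKU ha.1) (hKU hb.1)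
      have hη : ContDiff ℝ ∞ fun x => φ x - m * ψ₀ x := hφ.sub (contDiff_const.mul hψ₀)
      have hηs : ∀ x, x ∉ Icc a b → φ x - m * ψ₀ x = 0 := by
        intro x hx
        have h1 : x ∉ tsupport φ ∪ tsupport ψ₀ := fun h => hx ⟨ha.2 h, hb.2 h⟩
        rw [image_eq_zero_of_notMem_tsupport fun h => h1 (Or.inl h),
          image_eq_zero_of_notMem_tsupport fun h => h1 (Or.inr h), mul_zero, sub_zero]
      have hφi : Integrable φ := hφ.continuous.integrable_of_hasCompactSupport hφc
      have hψi : Integrable ψ₀ := hψ₀.continuous.integrable_of_hasCompactSupport hψ₀c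
      obtain ⟨Φ, hΦ, hΦc, hΦs, hΦd⟩ := exists_contDiff_deriv_eq hη hηs (by
        rw [integral_sub hφi (hψi.const_mul m), integral_const_mul, hψ₀1, ← hm]
        ring)
      have h1 := h Φ hΦ hΦc (hΦs.trans hab)
      rw [hΦd] at h1
      obtain ⟨i1, e1⟩ := hi f hf φ hφ hφc hφU
      obtain ⟨i2, -⟩ := hi f hf ψ₀ hψ₀ hψ₀c hψ₀U
      obtain ⟨i3, e3⟩ := hi (fun _ => c) continuousOn_const φ hφ hφc hφU
      obtain ⟨-, e4⟩ := hi (fun x => f x - c) (hf.sub continuousOn_const) φ hφ hφc hφU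
      have h2 : ∫ x in U, (φ x - m * ψ₀ x) • f x = (∫ x in U, φ x • f x) - m • c := by
        have i2' : IntegrableOn (fun x => m • ψ₀ x • f x) U := i2.smul m
        rw [hc, ← integral_smul, ← integral_sub i1 i2']
        refine integral_congr_ae (ae_of_all _ fun x => ?_)
        simp only [sub_smul, mul_smul]
      have h3 : ∫ x in U, φ x • c = m • c := by rw [← e3, integral_smul_const]
      rw [e4]
      simp_rw [smul_sub]
      rw [integral_sub i1 i3, h3, ← h2, h1])
  have h2 : f =ᵐ[volume.restrict U] fun _ => c := by
    refine (ae_restrict_iff' hU.measurableSet).2 ?_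
    filter_upwards [hae] with x hx hxU
    exact sub_eq_zero.1 (hx hxU)
  exact Measure.eqOn_open_of_ae_eq h2 hU hf continuousOn_const

/-- Integration by parts of a primitive against a function that vanishes at the right end. -/
theorem integral_deriv_mul_primitive {φ : ℝ → ℝ} (hφ : ContDiff ℝ ∞ φ) {g : ℝ → ℂ} {R : ℝ}
    (hR : 0 ≤ R) (hg : IntervalIntegrable g volume 0 R) (hφR : φ R = 0) :
    ∫ x in (0 : ℝ)..R, deriv φ x • ∫ t in (0 : ℝ)..x, g t = - ∫ x in (0 : ℝ)..R, φ x • g x := by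
  set ν := volume.restrict (Ioc 0 R) with hν
  have hgi : Integrable g ν := (intervalIntegrable_iff_integrableOn_Ioc_of_le hR).1 hg
  have hφ'c : Continuous (deriv φ) := hφ.continuous_deriv (by norm_num)
  have hφi : Integrable (fun x => ((deriv φ x : ℝ) : ℂ)) ν :=
    ((Complex.continuous_ofReal.comp hφ'c).integrableOn_Icc.mono_set Ioc_subset_Icc_self)
  -- Fubini on the triangle `t ≤ x`: integrating `φ'` from `t` to `R` leaves `-φ t`.
  let S : Set (ℝ × ℝ) := {z | z.2 ≤ z.1}
  have hS : MeasurableSet S := measurableSet_le measurable_snd measurable_fst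
  have hF : Integrable (S.indicator fun z : ℝ × ℝ => ((deriv φ z.1 : ℝ) : ℂ) * g z.2) (ν.prod ν) :=
    (hφi.mul_prod hgi).indicator hS
  have hswap := integral_integral_swap
    (f := fun x t => S.indicator (fun z : ℝ × ℝ => ((deriv φ z.1 : ℝ) : ℂ) * g z.2) (x, t)) hF
  rw [intervalIntegral.integral_of_le hR, intervalIntegral.integral_of_le hR]
  have h1 : ∫ x in Ioc 0 R, deriv φ x • ∫ t in (0 : ℝ)..x, g t =
      ∫ x, ∫ t, S.indicator (fun z : ℝ × ℝ => ((deriv φ z.1 : ℝ) : ℂ) * g z.2) (x, t) ∂ν ∂ν := by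
    refine setIntegral_congr_fun measurableSet_Ioc fun x hx => ?_
    have : (fun t => S.indicator (fun z : ℝ × ℝ => ((deriv φ z.1 : ℝ) : ℂ) * g z.2) (x, t)) =
        (Iic x).indicator fun t => ((deriv φ x : ℝ) : ℂ) * g t := by
      funext t
      simp only [indicator, S, mem_ofPred_eq, mem_Iic]
    rw [this, integral_indicator measurableSet_Iic, hν, Measure.restrict_restrict measurableSet_Iic,
      integral_const_mul, intervalIntegral.integral_of_le hx.1.le, Complex.real_smul]
    have : Iic x ∩ Ioc 0 R = Ioc 0 x := by
      ext t
      simp only [mem_inter_iff, mem_Iic, mem_Ioc]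
      exact ⟨fun h => ⟨h.2.1, h.1⟩, fun h => ⟨h.2, h.1, h.2.trans hx.2⟩⟩
    rw [this]
  have h2 : ∫ t, ∫ x, S.indicator (fun z : ℝ × ℝ => ((deriv φ z.1 : ℝ) : ℂ) * g z.2) (x, t) ∂ν ∂ν =
      ∫ t in Ioc 0 R, -(φ t • g t) := by
    refine setIntegral_congr_fun measurableSet_Ioc fun t ht => ?_
    have : (fun x => S.indicator (fun z : ℝ × ℝ => ((deriv φ z.1 : ℝ) : ℂ) * g z.2) (x, t)) =
        (Ici t).indicator fun x => ((deriv φ x : ℝ) : ℂ) * g t := by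
      funext x
      simp only [indicator, S, mem_ofPred_eq, mem_Ici]
    rw [this, integral_indicator measurableSet_Ici, hν, Measure.restrict_restrict measurableSet_Ici,
      integral_mul_const]
    have : Ici t ∩ Ioc 0 R = Icc t R := by
      ext x
      simp only [mem_inter_iff, mem_Ici, mem_Ioc, mem_Icc]
      exact ⟨fun h => ⟨h.1, h.2.2⟩, fun h => ⟨h.1, ht.1.trans_le h.1, h.2⟩⟩
    rw [this, integral_Icc_eq_integral_Ioc, ← intervalIntegral.integral_of_le ht.2,
      intervalIntegral.integral_ofReal,
      intervalIntegral.integral_deriv_eq_sub (fun x _ => (hφ.differentiable (by norm_num)) x)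
        (hφ'c.intervalIntegrable _ _), hφR, Complex.real_smul]
    push_cast
    ring
  rw [h1, hswap, h2, integral_neg]

/-! ### Functions on a metric graph -/

namespace MetricGraph

variable {V E : Type*} (G : MetricGraph V E)

/-- Lebesgue measure on an edge. -/
noncomputable def edgeMeasure (e : E) : Measure ℝ := volume.restrict (G.openInterval e)

theorem interval_eq_Ici {e : E} (h : G.len e = ⊤) : G.interval e = Ici 0 := by
  ext x; simp [interval, h]

theorem openInterval_eq_Ioi {e : E} (h : G.len e = ⊤) : G.openInterval e = Ioi 0 := by
  ext x; simp [openInterval, h]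

theorem interval_eq_Icc {e : E} (h : G.len e ≠ ⊤) : G.interval e = Icc 0 (G.len e).toReal := by
  ext x
  simp only [interval, mem_ofPred_eq, mem_Icc]
  rw [ENNReal.ofReal_le_iff_le_toReal h]

theorem openInterval_eq_Ioo {e : E} (h : G.len e ≠ ⊤) :
    G.openInterval e = Ioo 0 (G.len e).toReal := by
  ext x
  simp only [openInterval, mem_ofPred_eq, mem_Ioo]
  exact and_congr_right fun hx => ENNReal.ofReal_lt_iff_lt_toReal hx.le h

theorem isOpen_openInterval (e : E) : IsOpen (G.openInterval e) := by
  by_cases h : G.len e = ⊤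
  · rw [G.openInterval_eq_Ioi h]; exact isOpen_Ioi
  · rw [G.openInterval_eq_Ioo h]; exact isOpen_Ioo

theorem ordConnected_openInterval (e : E) : (G.openInterval e).OrdConnected := by
  by_cases h : G.len e = ⊤
  · rw [G.openInterval_eq_Ioi h]; exact ordConnected_Ioi
  · rw [G.openInterval_eq_Ioo h]; exact ordConnected_Ioo

theorem ordConnected_interval (e : E) : (G.interval e).OrdConnected := by
  by_cases h : G.len e = ⊤
  · rw [G.interval_eq_Ici h]; exact ordConnected_Ici
  · rw [G.interval_eq_Icc h]; exact ordConnected_Icc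

theorem openInterval_subset_interval (e : E) : G.openInterval e ⊆ G.interval e :=
  fun _ hx => ⟨hx.1.le, hx.2.le⟩

theorem zero_mem_interval (e : E) : (0 : ℝ) ∈ G.interval e := ⟨le_rfl, by simp⟩

theorem toReal_len_mem_interval {e : E} (h : G.len e ≠ ⊤) : (G.len e).toReal ∈ G.interval e := by
  rw [G.interval_eq_Icc h]; exact right_mem_Icc.2 ENNReal.toReal_nonneg

/-- Endpoints are null, so mass, potential and kinetic terms can all use one measure per edge. -/
theorem restrict_interval (e : E) : volume.restrict (G.interval e) = G.edgeMeasure e := by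
  unfold edgeMeasure
  by_cases h : G.len e = ⊤
  · rw [G.interval_eq_Ici h, G.openInterval_eq_Ioi h, restrict_Ioi_eq_restrict_Ici]
  · rw [G.interval_eq_Icc h, G.openInterval_eq_Ioo h, restrict_Ioo_eq_restrict_Icc]

/-- Edges of length zero are allowed; their open interval is empty, so density arguments must
exclude them. -/
theorem interval_subset_closure {e : E} (h : G.len e ≠ 0) :
    G.interval e ⊆ closure (G.openInterval e) := by
  by_cases h' : G.len e = ⊤
  · rw [G.interval_eq_Ici h', G.openInterval_eq_Ioi h', closure_Ioi]
  · rw [G.interval_eq_Icc h', G.openInterval_eq_Ioo h',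
      closure_Ioo (ENNReal.toReal_pos h h').ne]

theorem interval_eq_singleton {e : E} (h : G.len e = 0) : G.interval e = {0} := by
  rw [G.interval_eq_Icc (by simp [h]), h]; simp

instance (e : E) : SigmaFinite (G.edgeMeasure e) := by unfold edgeMeasure; infer_instance

theorem ae_mem_openInterval (e : E) : ∀ᵐ x ∂G.edgeMeasure e, x ∈ G.openInterval e :=
  ae_restrict_mem (G.isOpen_openInterval e).measurableSet

theorem ae_mem_interval (e : E) : ∀ᵐ x ∂G.edgeMeasure e, x ∈ G.interval e :=
  (G.ae_mem_openInterval e).mono fun _ hx => G.openInterval_subset_interval e hx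

theorem restrict_Ioc_le {e : E} {x y : ℝ} (hx : x ∈ G.interval e) (hy : y ∈ G.interval e) :
    volume.restrict (Ioc x y) ≤ G.edgeMeasure e := by
  rw [← G.restrict_interval]
  exact Measure.restrict_mono
    (Ioc_subset_Icc_self.trans ((G.ordConnected_interval e).out hx hy)) le_rfl

theorem intervalIntegrable {e : E} {g : ℝ → ℂ} (hg : MemLp g 2 (G.edgeMeasure e)) {x y : ℝ}
    (hx : x ∈ G.interval e) (hy : y ∈ G.interval e) : IntervalIntegrable g volume x y :=
  ⟨(hg.mono_measure (G.restrict_Ioc_le hx hy)).integrable (by norm_num),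
    (hg.mono_measure (G.restrict_Ioc_le hy hx)).integrable (by norm_num)⟩

theorem Icc_subset_interval {e : E} {x : ℝ} (hx : x ∈ G.interval e) : Icc 0 x ⊆ G.interval e :=
  (G.ordConnected_interval e).out (G.zero_mem_interval e) hx

theorem continuousOn_primitive {e : E} {g : ℝ → ℂ} (hg : MemLp g 2 (G.edgeMeasure e)) :
    ContinuousOn (fun x => ∫ t in (0 : ℝ)..x, g t) (G.interval e) := by
  let k : ℝ → ℂ := (G.openInterval e).indicator g
  have hk : MemLp k 2 volume :=
    (memLp_indicator_iff_restrict (G.isOpen_openInterval e).measurableSet).2 hg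
  have hki : ∀ a b : ℝ, IntervalIntegrable k volume a b := fun a b =>
    ⟨(hk.mono_measure Measure.restrict_le_self).integrable (by norm_num),
      (hk.mono_measure Measure.restrict_le_self).integrable (by norm_num)⟩
  refine (intervalIntegral.continuous_primitive hki 0).continuousOn.congr fun x hx => ?_
  have hgk : g =ᵐ[G.edgeMeasure e] k := by
    filter_upwards [G.ae_mem_openInterval e] with t ht
    simp [k, ht]
  simp only
  rw [intervalIntegral.integral_of_le hx.1, intervalIntegral.integral_of_le hx.1]
  exact integral_congr_ae (ae_mono (G.restrict_Ioc_le (G.zero_mem_interval e) hx) hgk)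

theorem hasWeakDerivOn_of_eq_integral {e : E} {f g : ℝ → ℂ} {c : ℂ}
    (hg : MemLp g 2 (G.edgeMeasure e))
    (hf : ∀ x ∈ G.interval e, f x = c + ∫ t in (0 : ℝ)..x, g t) :
    HasWeakDerivOn (G.openInterval e) f g := by
  intro φ hφ hφc hφU
  have hφ'c : Continuous (deriv φ) := hφ.continuous_deriv (by norm_num)
  rcases (tsupport φ).eq_empty_or_nonempty with h0 | hne
  · have : φ = 0 := tsupport_eq_empty_iff.1 h0
    simp [this]
  obtain ⟨b, hb⟩ := IsCompact.exists_isGreatest hφc hne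
  obtain ⟨r, hr, hrU⟩ := Metric.isOpen_iff.1 (G.isOpen_openInterval e) b (hφU hb.1)
  -- A point of the edge just beyond the support of `φ` reduces bounded edges and halflines alike to
  -- `[0, R]`, with no boundary terms.
  set R := b + r / 2 with hR
  have hRU : R ∈ G.openInterval e := hrU (by
    rw [Metric.mem_ball, Real.dist_eq, hR, add_sub_cancel_left, abs_of_pos (by positivity)]
    linarith)
  have hRI := G.openInterval_subset_interval e hRU
  have hRs : ∀ x, R ≤ x → x ∉ tsupport φ := fun x hx hx' => by
    have := hb.2 hx'
    linarith
  have hφR : φ R = 0 := image_eq_zero_of_notMem_tsupport (hRs R le_rfl)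
  have hφ0 : φ 0 = 0 := image_eq_zero_of_notMem_tsupport fun h => lt_irrefl _ (hφU h).1
  have hIoc : Ioc 0 R ⊆ G.openInterval e := fun x hx =>
    ⟨hx.1, (ENNReal.ofReal_le_ofReal hx.2).trans_lt hRU.2⟩
  have hcut : ∀ F : ℝ → ℂ, (∀ x, x ∉ tsupport φ → F x = 0) →
      ∫ x in G.openInterval e, F x = ∫ x in (0 : ℝ)..R, F x := by
    intro F hF
    rw [intervalIntegral.integral_of_le hRI.1]
    refine setIntegral_eq_of_subset_of_forall_sdiff_eq_zero
      (G.isOpen_openInterval e).measurableSet hIoc fun x hx => hF x fun hx' => ?_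
    exact hx.2 ⟨hx.1.1, le_of_not_ge fun h => hRs x h hx'⟩
  rw [hcut (fun x => deriv φ x • f x) fun x hx => by
      rw [image_eq_zero_of_notMem_tsupport fun h => hx (tsupport_deriv_subset h), zero_smul],
    hcut (fun x => φ x • g x) fun x hx => by
      rw [image_eq_zero_of_notMem_tsupport hx, zero_smul]]
  have hgi := G.intervalIntegrable hg (G.zero_mem_interval e) hRI
  rw [← integral_deriv_mul_primitive hφ hRI.1 hgi hφR]
  have h1 : ∫ x in (0 : ℝ)..R, deriv φ x • f x =
      ∫ x in (0 : ℝ)..R, (deriv φ x • c + deriv φ x • ∫ t in (0 : ℝ)..x, g t) := by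
    refine intervalIntegral.integral_congr fun x hx => ?_
    rw [uIcc_of_le hRI.1] at hx
    rw [hf x (G.Icc_subset_interval hRI hx), smul_add]
  have hi1 : IntervalIntegrable (fun x => deriv φ x • c) volume 0 R :=
    (hφ'c.smul continuous_const).intervalIntegrable _ _
  have hi2 : IntervalIntegrable (fun x => deriv φ x • ∫ t in (0 : ℝ)..x, g t) volume 0 R := by
    refine ContinuousOn.intervalIntegrable ?_
    rw [uIcc_of_le hRI.1]
    exact hφ'c.continuousOn.smul ((G.continuousOn_primitive hg).mono (G.Icc_subset_interval hRI))
  rw [h1, intervalIntegral.integral_add hi1 hi2, intervalIntegral.integral_smul_const,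
    intervalIntegral.integral_deriv_eq_sub (fun x _ => (hφ.differentiable (by norm_num)) x)
      (hφ'c.intervalIntegrable _ _), hφR, hφ0, sub_zero, zero_smul, zero_add]

/-- The difference between `f` and the primitive of `g` has weak derivative zero, so it is constant
by du Bois-Reymond on the open edge, and on the closed edge by density. -/
theorem eq_integral_of_hasWeakDerivOn {e : E} {f g : ℝ → ℂ} (hf : ContinuousOn f (G.interval e))
    (hg : MemLp g 2 (G.edgeMeasure e)) (h : HasWeakDerivOn (G.openInterval e) f g) {x : ℝ}
    (hx : x ∈ G.interval e) : f x = f 0 + ∫ t in (0 : ℝ)..x, g t := by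
  by_cases h0 : G.len e = 0
  · rw [G.interval_eq_singleton h0, mem_singleton_iff] at hx
    simp [hx]
  have hF := G.continuousOn_primitive hg
  have hFw : HasWeakDerivOn (G.openInterval e) (fun x => ∫ t in (0 : ℝ)..x, g t) g :=
    G.hasWeakDerivOn_of_eq_integral hg (c := 0) fun x _ => by simp
  have hsub := G.openInterval_subset_interval e
  obtain ⟨c, hc⟩ := eqOn_const_of_integral_deriv_smul_eq_zero (G.isOpen_openInterval e)
    (G.ordConnected_openInterval e) (f := fun x => f x - ∫ t in (0 : ℝ)..x, g t)
    ((hf.sub hF).mono hsub) (fun φ hφ hφc hφU => by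
      have hφ'c : Continuous (deriv φ) := hφ.continuous_deriv (by norm_num)
      have hi : ∀ w : ℝ → ℂ, ContinuousOn w (G.interval e) →
          IntegrableOn (fun x => deriv φ x • w x) (G.openInterval e) := by
        intro w hw
        have h2 : IntegrableOn (fun x => deriv φ x • w x) (tsupport φ) :=
          (hφ'c.continuousOn.smul (hw.mono (hφU.trans hsub))).integrableOn_compact hφc
        refine ((integrableOn_iff_integrable_of_support_subset fun x hx => ?_).1 h2).integrableOn
        by_contra hx'
        refine hx ?_
        simp only
        rw [image_eq_zero_of_notMem_tsupport fun h => hx' (tsupport_deriv_subset h), zero_smul]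
      simp_rw [smul_sub]
      rw [integral_sub (hi _ hf) (hi _ hF), h φ hφ hφc hφU, hFw φ hφ hφc hφU, sub_self])
  have hall : EqOn (fun x => f x - ∫ t in (0 : ℝ)..x, g t) (fun _ => c) (G.interval e) :=
    Set.EqOn.of_subset_closure hc (hf.sub hF) continuousOn_const hsub
      (G.interval_subset_closure h0)
  have h1 := hall hx
  have h2 := hall (G.zero_mem_interval e)
  simp only [intervalIntegral.integral_same, sub_zero] at h1 h2
  rw [h2, ← h1]
  ring

/-- `u` is in `H¹(G)` and `g` is its derivative. -/
structure HasL2Deriv (u g : E → ℝ → ℂ) : Prop where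
  vertex : ∃ c : V → ℂ, ∀ e, u e 0 = c (G.src e) ∧
    (G.len e ≠ ⊤ → u e (G.len e).toReal = c (G.tgt e))
  memLp : ∀ e, MemLp (u e) 2 (G.edgeMeasure e)
  deriv_memLp : ∀ e, MemLp (g e) 2 (G.edgeMeasure e)
  eq_integral : ∀ e, ∀ x ∈ G.interval e, u e x = u e 0 + ∫ t in (0 : ℝ)..x, g e t

variable {G}

theorem HasL2Deriv.continuousOn {u g : E → ℝ → ℂ} (h : G.HasL2Deriv u g) (e : E) :
    ContinuousOn (u e) (G.interval e) :=
  (continuousOn_const.add (G.continuousOn_primitive (h.deriv_memLp e))).congr (h.eq_integral e)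

theorem HasL2Deriv.hasWeakDerivOn {u g : E → ℝ → ℂ} (h : G.HasL2Deriv u g) (e : E) :
    HasWeakDerivOn (G.openInterval e) (u e) (g e) :=
  G.hasWeakDerivOn_of_eq_integral (h.deriv_memLp e) (h.eq_integral e)

/-- From here on, membership in H¹ is used as an integral representation, which passes to limits and
yields pointwise bounds. -/
theorem memH1_iff {u : E → ℝ → ℂ} : G.MemH1 u ↔ ∃ g, G.HasL2Deriv u g := by
  constructor
  · rintro ⟨⟨hc, hv⟩, h⟩
    choose h1 g hg hw using h
    refine ⟨g, hv, fun e => ?_, hg, fun e x hx =>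
      G.eq_integral_of_hasWeakDerivOn (hc e) (hg e) (hw e) hx⟩
    rw [← G.restrict_interval]
    exact h1 e
  · rintro ⟨g, h⟩
    refine ⟨⟨h.continuousOn, h.vertex⟩, fun e => ⟨?_, g e, h.deriv_memLp e, h.hasWeakDerivOn e⟩⟩
    rw [G.restrict_interval]
    exact h.memLp e

theorem HasL2Deriv.weakDeriv_ae_eq {u g : E → ℝ → ℂ} (h : G.HasL2Deriv u g) (e : E) :
    weakDeriv (G.openInterval e) (u e) =ᵐ[G.edgeMeasure e] g e := by
  have hex : ∃ k, MemLp k 2 (volume.restrict (G.openInterval e)) ∧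
      HasWeakDerivOn (G.openInterval e) (u e) k := ⟨g e, h.deriv_memLp e, h.hasWeakDerivOn e⟩
  unfold weakDeriv
  rw [dif_pos hex]
  exact hex.choose_spec.2.ae_unique (G.isOpen_openInterval e) (h.hasWeakDerivOn e)
    hex.choose_spec.1 (h.deriv_memLp e)

theorem mass_eq [Fintype E] (u : E → ℝ → ℂ) :
    G.mass u = ∑ e, ∫ x, ‖u e x‖ ^ 2 ∂G.edgeMeasure e := by
  simp_rw [mass, G.restrict_interval]

theorem HasL2Deriv.energy_eq [Fintype E] {u g : E → ℝ → ℂ} (h : G.HasL2Deriv u g) (p : ℝ) :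
    G.energy p u = 1 / 2 * (∑ e, ∫ x, ‖g e x‖ ^ 2 ∂G.edgeMeasure e)
      - 1 / p * (∑ e, ∫ x, ‖u e x‖ ^ p ∂G.edgeMeasure e) := by
  simp_rw [energy, G.restrict_interval]
  congr 2
  refine Finset.sum_congr rfl fun e _ => integral_congr_ae ?_
  filter_upwards [h.weakDeriv_ae_eq e] with x hx
  rw [hx]

theorem HasL2Deriv.sub {u g v k : E → ℝ → ℂ} (h : G.HasL2Deriv u g) (h' : G.HasL2Deriv v k) :
    G.HasL2Deriv (fun e x => u e x - v e x) (fun e x => g e x - k e x) := by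
  obtain ⟨c, hc⟩ := h.vertex
  obtain ⟨d, hd⟩ := h'.vertex
  refine ⟨⟨fun v => c v - d v, fun e => ⟨by rw [(hc e).1, (hd e).1], fun he => by
    rw [(hc e).2 he, (hd e).2 he]⟩⟩, fun e => (h.memLp e).sub (h'.memLp e),
    fun e => (h.deriv_memLp e).sub (h'.deriv_memLp e), fun e x hx => ?_⟩
  have hz := G.zero_mem_interval e
  rw [intervalIntegral.integral_sub (G.intervalIntegrable (h.deriv_memLp e) hz hx)
    (G.intervalIntegrable (h'.deriv_memLp e) hz hx), h.eq_integral e x hx, h'.eq_integral e x hx]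
  ring

theorem HasL2Deriv.const_mul {u g : E → ℝ → ℂ} (h : G.HasL2Deriv u g) (s : ℂ) :
    G.HasL2Deriv (fun e x => s * u e x) (fun e x => s * g e x) := by
  obtain ⟨c, hc⟩ := h.vertex
  refine ⟨⟨fun v => s * c v, fun e => ⟨by rw [(hc e).1], fun he => by rw [(hc e).2 he]⟩⟩,
    fun e => (h.memLp e).const_mul s, fun e => (h.deriv_memLp e).const_mul s, fun e x hx => ?_⟩
  rw [intervalIntegral.integral_const_mul, h.eq_integral e x hx]
  ring

end MetricGraph

/-! ### Pointwise bounds, decay and coercivity -/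

/-- The Cauchy–Schwarz inequality. -/
theorem integral_norm_mul_norm_le_sqrt {α : Type*} [MeasurableSpace α] {ν : Measure α}
    {f k : α → ℂ} (hf : MemLp f 2 ν) (hk : MemLp k 2 ν) :
    ∫ x, ‖f x‖ * ‖k x‖ ∂ν ≤ √(∫ x, ‖f x‖ ^ 2 ∂ν) * √(∫ x, ‖k x‖ ^ 2 ∂ν) := by
  have h := integral_mul_norm_le_Lp_mul_Lq (μ := ν) (f := f) (g := k) Real.HolderConjugate.two_two
    (by simpa using hf) (by simpa using hk)
  simpa [Real.sqrt_eq_rpow] using h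

/-- Sublinear powers are dominated by small multiples of the square. -/
theorem exists_rpow_le_mul_sq_add {q ε : ℝ} (hq0 : 0 ≤ q) (hq : q < 2) (hε : 0 < ε) :
    ∃ C : ℝ, ∀ y : ℝ, 0 ≤ y → y ^ q ≤ ε * y ^ 2 + C := by
  -- `K` solves `K^(q-2) = ε`: beyond it the square dominates, below it the power is at most `K^q`.
  set K : ℝ := ε ^ (1 / (q - 2)) with hK
  have hK0 : 0 < K := by positivity
  refine ⟨K ^ q, fun y hy => ?_⟩
  rcases le_or_gt y K with h | h
  · have := Real.rpow_le_rpow hy h hq0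
    have : 0 ≤ ε * y ^ 2 := by positivity
    linarith
  · have hy0 : 0 < y := hK0.trans h
    have h1 : y ^ q = y ^ (q - 2) * y ^ 2 := by
      rw [← Real.rpow_natCast y 2, ← Real.rpow_add hy0]
      norm_num
    have h2 : y ^ (q - 2) ≤ ε := by
      have h3 := Real.rpow_le_rpow_of_nonpos hK0 h.le (by linarith : q - 2 ≤ 0)
      rwa [hK, ← Real.rpow_mul hε.le, one_div_mul_cancel (by linarith), Real.rpow_one] at h3
    have h3 := mul_le_mul_of_nonneg_right h2 (by positivity : 0 ≤ y ^ 2)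
    have : 0 ≤ K ^ q := by positivity
    linarith

namespace MetricGraph

variable {V E : Type*} {G : MetricGraph V E}

theorem integral_sq_le_sum [Fintype E] (f : E → ℝ → ℂ) (e : E) :
    ∫ x, ‖f e x‖ ^ 2 ∂G.edgeMeasure e ≤ ∑ e, ∫ x, ‖f e x‖ ^ 2 ∂G.edgeMeasure e :=
  Finset.single_le_sum (f := fun e => ∫ x, ‖f e x‖ ^ 2 ∂G.edgeMeasure e)
    (fun e _ => integral_nonneg fun x => by positivity) (Finset.mem_univ e)

namespace HasL2Deriv

variable {u g : E → ℝ → ℂ}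

theorem integrable_sq (h : G.HasL2Deriv u g) (e : E) :
    Integrable (fun x => ‖u e x‖ ^ 2) (G.edgeMeasure e) :=
  (memLp_two_iff_integrable_sq_norm (h.memLp e).1).1 (h.memLp e)

theorem integrable_deriv_sq (h : G.HasL2Deriv u g) (e : E) :
    Integrable (fun x => ‖g e x‖ ^ 2) (G.edgeMeasure e) :=
  (memLp_two_iff_integrable_sq_norm (h.deriv_memLp e).1).1 (h.deriv_memLp e)

theorem integrable_mul (h : G.HasL2Deriv u g) (e : E) :
    Integrable (fun x => ‖u e x‖ * ‖g e x‖) (G.edgeMeasure e) :=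
  (h.memLp e).norm.integrable_mul (h.deriv_memLp e).norm

theorem abs_sub_comp_norm_le (h : G.HasL2Deriv u g) {e : E} {x y : ℝ} (hx : x ∈ G.interval e)
    (hy : y ∈ G.interval e) (hxy : x ≤ y) {H K : ℝ → ℝ} (hH : ∀ s, HasDerivAt H (K s) s)
    (hK : Continuous K) :
    |H ‖u e y‖ - H ‖u e x‖| ≤ ∫ t in x..y, |K ‖u e t‖| * ‖g e t‖ := by
  refine abs_sub_comp_norm_le_integral hxy (G.intervalIntegrable (h.deriv_memLp e) hx hy)
    (fun z hz => ?_) hH hK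
  have hzI := (G.ordConnected_interval e).out hx hy hz
  have h0 := G.zero_mem_interval e
  rw [h.eq_integral e z hzI, h.eq_integral e x hx, add_assoc,
    intervalIntegral.integral_add_adjacent_intervals
      (G.intervalIntegrable (h.deriv_memLp e) h0 hx)
      (G.intervalIntegrable (h.deriv_memLp e) hx hzI)]

/-- Somewhere on `(a, b]` the value of `‖u‖²` is at most its average; moving from there to `x`
changes it by at most `2∫‖u‖‖u'‖`. -/
theorem norm_sq_le_of_mem_Icc (h : G.HasL2Deriv u g) {e : E} {a b x : ℝ} (ha : a ∈ G.interval e)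
    (hb : b ∈ G.interval e) (hab : a < b) (hx : x ∈ Icc a b) :
    ‖u e x‖ ^ 2 ≤ (b - a)⁻¹ * (∫ t in Ioc a b, ‖u e t‖ ^ 2) +
      2 * ∫ t in Ioc a b, ‖u e t‖ * ‖g e t‖ := by
  have hi1 : IntegrableOn (fun t => ‖u e t‖ ^ 2) (Ioc a b) :=
    (h.integrable_sq e).mono_measure (G.restrict_Ioc_le ha hb)
  have hi2 : IntegrableOn (fun t => 2 * (‖u e t‖ * ‖g e t‖)) (Ioc a b) :=
    ((h.integrable_mul e).mono_measure (G.restrict_Ioc_le ha hb)).const_mul 2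
  obtain ⟨y, hy, hyle⟩ := exists_le_setAverage (μ := volume) (s := Ioc a b)
    (by simp [hab]) (by simp) hi1
  rw [setAverage_eq, smul_eq_mul, Measure.real, Real.volume_Ioc,
    ENNReal.toReal_ofReal (by linarith)] at hyle
  have hsub := (G.ordConnected_interval e).out ha hb
  have hy' : y ∈ Icc a b := Ioc_subset_Icc_self hy
  have key : ∀ s ∈ Icc a b, ∀ t ∈ Icc a b, s ≤ t → |‖u e t‖ ^ 2 - ‖u e s‖ ^ 2| ≤
      ∫ t in Ioc a b, 2 * (‖u e t‖ * ‖g e t‖) := by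
    intro s hs t ht hst
    have h1 := h.abs_sub_comp_norm_le (hsub hs) (hsub ht) hst (H := fun s => s ^ 2)
      (K := fun s => 2 * s) (fun s => by simpa using hasDerivAt_pow 2 s) (by fun_prop)
    refine h1.trans ?_
    rw [intervalIntegral.integral_of_le hst]
    have h2 : ∀ t, |2 * ‖u e t‖| * ‖g e t‖ = 2 * (‖u e t‖ * ‖g e t‖) := fun t => by
      rw [abs_of_nonneg (by positivity)]; ring
    simp_rw [h2]
    exact setIntegral_mono_set hi2 (ae_of_all _ fun t => by positivity)
      (Ioc_subset_Ioc hs.1 ht.2).eventuallyLE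
  rw [integral_const_mul] at key
  rcases le_total x y with hxy | hxy
  · have := neg_abs_le (‖u e y‖ ^ 2 - ‖u e x‖ ^ 2)
    linarith [key x hx y hy' hxy]
  · have := le_abs_self (‖u e x‖ ^ 2 - ‖u e y‖ ^ 2)
    linarith [key y hy' x hx hxy]

/-- Every point of the edge lies in a subinterval of length exactly `L`, either `[0, L]` or `[x - L,
x]`; Cauchy–Schwarz does the rest. -/
theorem norm_sq_le (h : G.HasL2Deriv u g) {e : E} {L x : ℝ} (hL : 0 < L) (hLe : L ∈ G.interval e)
    (hx : x ∈ G.interval e) :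
    ‖u e x‖ ^ 2 ≤ L⁻¹ * (∫ t, ‖u e t‖ ^ 2 ∂G.edgeMeasure e) +
      2 * (√(∫ t, ‖u e t‖ ^ 2 ∂G.edgeMeasure e) * √(∫ t, ‖g e t‖ ^ 2 ∂G.edgeMeasure e)) := by
  have key : ∀ a b : ℝ, a ∈ G.interval e → b ∈ G.interval e → b - a = L → x ∈ Icc a b →
      ‖u e x‖ ^ 2 ≤ L⁻¹ * (∫ t, ‖u e t‖ ^ 2 ∂G.edgeMeasure e) +
      2 * (√(∫ t, ‖u e t‖ ^ 2 ∂G.edgeMeasure e) * √(∫ t, ‖g e t‖ ^ 2 ∂G.edgeMeasure e)) := by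
    intro a b ha hb hab hxab
    have h1 := h.norm_sq_le_of_mem_Icc ha hb (by linarith) hxab
    rw [hab] at h1
    have h2 : ∫ t in Ioc a b, ‖u e t‖ ^ 2 ≤ ∫ t, ‖u e t‖ ^ 2 ∂G.edgeMeasure e :=
      integral_mono_measure (G.restrict_Ioc_le ha hb) (ae_of_all _ fun t => by positivity)
        (h.integrable_sq e)
    have h3 : ∫ t in Ioc a b, ‖u e t‖ * ‖g e t‖ ≤ ∫ t, ‖u e t‖ * ‖g e t‖ ∂G.edgeMeasure e :=
      integral_mono_measure (G.restrict_Ioc_le ha hb) (ae_of_all _ fun t => by positivity)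
        (h.integrable_mul e)
    have h4 := integral_norm_mul_norm_le_sqrt (h.memLp e) (h.deriv_memLp e)
    have h5 := mul_le_mul_of_nonneg_left h2 (inv_pos.2 hL).le
    linarith
  have h0 := G.zero_mem_interval e
  rcases le_total x L with hxL | hxL
  · exact key 0 L h0 hLe (sub_zero L) ⟨hx.1, hxL⟩
  · exact key (x - L) x ((G.ordConnected_interval e).out h0 hx ⟨by linarith, by linarith⟩) hx
      (by ring) ⟨by linarith, le_rfl⟩

/-- The interval bound on `[x, x + 1]` is an increment of a convergent integral. -/
theorem tendsto_atTop_zero (h : G.HasL2Deriv u g) {e : E} (he : G.len e = ⊤) :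
    Tendsto (fun x => ‖u e x‖) atTop (𝓝 0) := by
  have hI := G.interval_eq_Ici he
  set f : ℝ → ℝ := fun t => ‖u e t‖ ^ 2 + 2 * (‖u e t‖ * ‖g e t‖) with hf
  have hfi : IntegrableOn f (Ioi 0) := by
    have := (h.integrable_sq e).add ((h.integrable_mul e).const_mul 2)
    rw [edgeMeasure, G.openInterval_eq_Ioi he] at this
    exact this
  have h1 : Tendsto (fun x : ℝ => ∫ t in (0 : ℝ)..x, f t) atTop (𝓝 (∫ t in Ioi 0, f t)) :=
    intervalIntegral_tendsto_integral_Ioi 0 hfi tendsto_id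
  have h2 := (h1.comp (tendsto_atTop_add_const_right atTop (1 : ℝ) tendsto_id)).sub h1
  rw [sub_self] at h2
  have h3 : Tendsto (fun x => ‖u e x‖ ^ 2) atTop (𝓝 0) := by
    refine squeeze_zero' (Eventually.of_forall fun x => by positivity) ?_ h2
    filter_upwards [eventually_ge_atTop 0] with x hx
    have hxI : x ∈ G.interval e := by rw [hI]; exact hx
    have hx1 : x + 1 ∈ G.interval e := by rw [hI]; exact mem_Ici.2 (by linarith)
    have hII : ∀ a b, 0 ≤ a → 0 ≤ b → IntervalIntegrable f volume a b := fun a b ha hb =>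
      ⟨hfi.mono_set (Ioc_subset_Ioi_self.trans (Ioi_subset_Ioi ha)),
        hfi.mono_set (Ioc_subset_Ioi_self.trans (Ioi_subset_Ioi hb))⟩
    have h4 := h.norm_sq_le_of_mem_Icc hxI hx1 (by linarith) (left_mem_Icc.2 (by linarith))
    have i1 : IntegrableOn (fun t => ‖u e t‖ ^ 2) (Ioc x (x + 1)) :=
      (h.integrable_sq e).mono_measure (G.restrict_Ioc_le hxI hx1)
    have i2 : IntegrableOn (fun t => 2 * (‖u e t‖ * ‖g e t‖)) (Ioc x (x + 1)) :=
      ((h.integrable_mul e).mono_measure (G.restrict_Ioc_le hxI hx1)).const_mul 2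
    rw [add_sub_cancel_left, inv_one, one_mul, ← integral_const_mul, ← integral_add i1 i2,
      ← intervalIntegral.integral_of_le (by linarith)] at h4
    have h5 := intervalIntegral.integral_interval_sub_left (hII 0 (x + 1) le_rfl (by linarith))
      (hII 0 x le_rfl hx)
    simp only [Function.comp_apply, id_eq]
    rw [h5]
    exact h4
  have h4 := h3.sqrt
  simpa [Real.sqrt_sq] using h4

theorem exists_isMaxOn (h : G.HasL2Deriv u g) {e : E} (he : G.len e = ⊤) :
    ∃ x ∈ G.interval e, ∀ y ∈ G.interval e, ‖u e y‖ ≤ ‖u e x‖ := by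
  have hI := G.interval_eq_Ici he
  by_cases h0 : ∀ y ∈ G.interval e, ‖u e y‖ = 0
  · exact ⟨0, G.zero_mem_interval e, fun y hy => by rw [h0 y hy]; positivity⟩
  · push Not at h0
    obtain ⟨z, hz, hz0⟩ := h0
    have hc := (h.continuousOn e).norm
    refine hc.exists_isMaxOn' (by rw [hI]; exact isClosed_Ici) hz ?_
    rw [hI, cocompact_eq_atBot_atTop, inf_sup_right, (disjoint_atBot_principal_Ici (0 : ℝ)).eq_bot,
      bot_sup_eq]
    exact ((h.tendsto_atTop_zero he).eventually_le_const
      (lt_of_le_of_ne (norm_nonneg _) (Ne.symm hz0))).filter_mono inf_le_left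

variable [Fintype E]

variable (G) in
-- A Gagliardo–Nirenberg bound with `A` depending on the graph only: the sum of inverse reference
-- lengths, taken as 1 on halflines.
theorem exists_norm_sq_le : ∃ A : ℝ, 0 ≤ A ∧ ∀ u g : E → ℝ → ℂ, G.HasL2Deriv u g →
    ∀ e, G.len e ≠ 0 → ∀ x ∈ G.interval e, ‖u e x‖ ^ 2 ≤ A * G.mass u +
      2 * (√(G.mass u) * √(∑ e, ∫ x, ‖g e x‖ ^ 2 ∂G.edgeMeasure e)) := by
  have hex : ∀ e, ∃ L : ℝ, 0 < L ∧ (G.len e ≠ 0 → L ∈ G.interval e) := by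
    intro e
    by_cases h0 : G.len e = 0
    · exact ⟨1, one_pos, fun h => absurd h0 h⟩
    by_cases ht : G.len e = ⊤
    · exact ⟨1, one_pos, fun _ => by rw [G.interval_eq_Ici ht]; exact mem_Ici.2 zero_le_one⟩
    · exact ⟨(G.len e).toReal, ENNReal.toReal_pos h0 ht, fun _ => G.toReal_len_mem_interval ht⟩
  choose L hL hLe using hex
  refine ⟨∑ e, (L e)⁻¹, Finset.sum_nonneg fun e _ => (inv_pos.2 (hL e)).le,
    fun u g h e he x hx => ?_⟩
  have h1 := h.norm_sq_le (hL e) (hLe e he) hx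
  have h2 : (L e)⁻¹ ≤ ∑ e, (L e)⁻¹ := Finset.single_le_sum (f := fun e => (L e)⁻¹)
    (fun e _ => (inv_pos.2 (hL e)).le) (Finset.mem_univ e)
  rw [mass_eq]
  refine h1.trans ?_
  gcongr
  · exact Finset.sum_nonneg fun e _ => (inv_pos.2 (hL e)).le
  · exact integral_sq_le_sum u e
  · exact integral_sq_le_sum u e
  · exact integral_sq_le_sum g e

end HasL2Deriv

/-- A bound on the edges of positive length also bounds the values at the vertices. -/
theorem HasL2Deriv.exists_bounded_vertex {u g : E → ℝ → ℂ} (h : G.HasL2Deriv u g)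
    (hconn : G.Connected) (hnc : G.Noncompact) {K : ℝ}
    (hK : ∀ e, G.len e ≠ 0 → ∀ x ∈ G.interval e, ‖u e x‖ ≤ K) :
    ∃ c : V → ℂ, (∀ v, ‖c v‖ ≤ K) ∧ ∀ e, u e 0 = c (G.src e) ∧
      (G.len e ≠ ⊤ → u e (G.len e).toReal = c (G.tgt e)) := by
  classical
  obtain ⟨c, hc⟩ := h.vertex
  obtain ⟨e₀, he₀⟩ := hnc
  have hK0 : 0 ≤ K := (norm_nonneg _).trans (hK e₀ (by simp [he₀]) 0 (G.zero_mem_interval e₀))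
  -- The bound spreads along edges: edges of length zero transmit the vertex value, all others are
  -- bounded by `hK`. Connectedness carries it from a halfline to every vertex.
  let Q : V → Prop := fun v => v ∈ G.infVertices ∨ ‖c v‖ ≤ K
  have hsrc : ∀ e, G.len e ≠ 0 → ‖c (G.src e)‖ ≤ K := fun e he => by
    rw [← (hc e).1]; exact hK e he 0 (G.zero_mem_interval e)
  have hedge : ∀ e, Q (G.src e) ↔ Q (G.tgt e) := by
    intro e
    by_cases h0 : G.len e = 0
    · have ht : G.len e ≠ ⊤ := by simp [h0]
      have h1 : c (G.src e) = c (G.tgt e) := by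
        rw [← (hc e).1, ← (hc e).2 ht, h0, ENNReal.toReal_zero]
      have h2 : G.tgt e ∉ G.infVertices := fun h => ht ((G.tgt_mem_iff e).1 h)
      simp only [Q, h1, h2, G.src_notMem e, false_or]
    · refine iff_of_true (Or.inr (hsrc e h0)) ?_
      by_cases ht : G.len e = ⊤
      · exact Or.inl ((G.tgt_mem_iff e).2 ht)
      · refine Or.inr ?_
        rw [← (hc e).2 ht]
        exact hK e h0 _ (G.toReal_len_mem_interval ht)
  have hQ : ∀ v w, Relation.EqvGen (fun a b => ∃ e, G.src e = a ∧ G.tgt e = b) v w →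
      (Q v ↔ Q w) := by
    intro v w hvw
    induction hvw with
    | rel a b hab => obtain ⟨e, rfl, rfl⟩ := hab; exact hedge e
    | refl a => exact Iff.rfl
    | symm a b _ ih => exact ih.symm
    | trans a b c _ _ ih1 ih2 => exact ih1.trans ih2
  have hall : ∀ v, Q v := fun v =>
    (hQ _ v (hconn (G.src e₀) v)).1 (Or.inr (hsrc e₀ (by simp [he₀])))
  -- At vertices at infinity the value of `c` is unconstrained and possibly large, so it is reset to
  -- 0.
  refine ⟨fun v => if v ∈ G.infVertices then 0 else c v, fun v => ?_, fun e => ⟨?_, fun he => ?_⟩⟩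
  · by_cases hv : v ∈ G.infVertices
    · simpa [hv] using hK0
    · simpa [hv] using (hall v).resolve_left hv
  · simp only
    rw [if_neg (G.src_notMem e), (hc e).1]
  · simp only
    rw [if_neg fun h => he ((G.tgt_mem_iff e).1 h), (hc e).2 he]

/-- The energy controls the derivative: the exponent `p < 6` is subcritical. -/
theorem exists_deriv_le_energy (G : MetricGraph V E) [Fintype E] {p μ : ℝ}
    (hp2 : 2 < p) (hp6 : p < 6) (hμ : 0 < μ) :
    ∃ D : ℝ, ∀ u g : E → ℝ → ℂ, G.HasL2Deriv u g → G.mass u = μ →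
      ∑ e, ∫ x, ‖g e x‖ ^ 2 ∂G.edgeMeasure e ≤ 4 * G.energy p u + D := by
  obtain ⟨A, hA, hbd⟩ := HasL2Deriv.exists_norm_sq_le G
  have hp : 0 < p := by linarith
  -- Chosen so that `(μ/p) · ε · 8μT = T/4`, half of the kinetic energy. The supremum of `‖u‖²`
  -- grows like `√T`, and `p < 6` makes the exponent `(p - 2)/2` smaller than 2.
  set ε : ℝ := p / (32 * μ ^ 2) with hε
  have hε0 : 0 < ε := by positivity
  obtain ⟨C, hC⟩ := exists_rpow_le_mul_sq_add (q := (p - 2) / 2) (by linarith) (by linarith) hε0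
  refine ⟨4 * (μ / p * (ε * (2 * (A * μ) ^ 2) + C)), fun u g h hm => ?_⟩
  set T := ∑ e, ∫ x, ‖g e x‖ ^ 2 ∂G.edgeMeasure e with hT
  have hT0 : 0 ≤ T := Finset.sum_nonneg fun e _ => integral_nonneg fun x => by positivity
  set y := A * μ + 2 * (√μ * √T) with hy
  have hy0 : 0 ≤ y := by positivity
  have hsup : ∀ e, ∀ᵐ x ∂G.edgeMeasure e, ‖u e x‖ ≤ √y := by
    intro e
    by_cases h0 : G.len e = 0
    · have : G.edgeMeasure e = 0 := by
        rw [edgeMeasure, G.openInterval_eq_Ioo (by simp [h0]), h0]; simp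
      rw [this]; simp
    · filter_upwards [G.ae_mem_interval e] with x hx
      have := hbd u g h e h0 x hx
      rw [hm] at this
      exact Real.le_sqrt_of_sq_le this
  have hP : ∑ e, ∫ x, ‖u e x‖ ^ p ∂G.edgeMeasure e ≤ y ^ ((p - 2) / 2) * μ := by
    rw [← hm, mass_eq, Finset.mul_sum]
    refine Finset.sum_le_sum fun e _ => ?_
    have h1 := ((h.memLp e).integrable_norm_rpow_of_bounded hp2.le (hsup e)).2
    rwa [Real.sqrt_eq_rpow, ← Real.rpow_mul hy0, one_div_mul_eq_div] at h1
  have h1 := hC y hy0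
  have h2 : y ^ 2 ≤ 2 * (A * μ) ^ 2 + 8 * μ * T := by
    have h3 : (√μ * √T) ^ 2 = μ * T := by
      rw [mul_pow, Real.sq_sqrt hμ.le, Real.sq_sqrt hT0]
    nlinarith [sq_nonneg (A * μ - 2 * (√μ * √T))]
  have h3 : 1 / p * ∑ e, ∫ x, ‖u e x‖ ^ p ∂G.edgeMeasure e ≤
      μ / p * (ε * (2 * (A * μ) ^ 2) + C) + T / 4 := by
    calc 1 / p * ∑ e, ∫ x, ‖u e x‖ ^ p ∂G.edgeMeasure e
        ≤ 1 / p * (y ^ ((p - 2) / 2) * μ) := mul_le_mul_of_nonneg_left hP (by positivity)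
      _ = μ / p * y ^ ((p - 2) / 2) := by ring
      _ ≤ μ / p * (ε * (2 * (A * μ) ^ 2 + 8 * μ * T) + C) := by
        refine mul_le_mul_of_nonneg_left (h1.trans ?_) (by positivity)
        have := mul_le_mul_of_nonneg_left h2 hε0.le
        linarith
      _ = μ / p * (ε * (2 * (A * μ) ^ 2) + C) + T / 4 := by
        rw [hε]; field_simp; ring
  rw [h.energy_eq]
  linarith

end MetricGraph

/-! ### Compactness, splitting and scaling -/

namespace MetricGraph

variable {V E : Type*} {G : MetricGraph V E}

theorem edgeMeasure_eq_zero {e : E} (h : G.len e = 0) : G.edgeMeasure e = 0 := by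
  rw [edgeMeasure, G.openInterval_eq_Ioo (by simp [h]), h]; simp

theorem ae_of_forall_mem_interval {P : ℝ → Prop} {e : E}
    (h : G.len e ≠ 0 → ∀ x ∈ G.interval e, P x) : ∀ᵐ x ∂G.edgeMeasure e, P x := by
  by_cases h0 : G.len e = 0
  · rw [edgeMeasure_eq_zero h0]; simp
  · exact (G.ae_mem_interval e).mono (h h0)

theorem integral_sq_le_mass [Fintype E] (u : E → ℝ → ℂ) (e : E) :
    ∫ x, ‖u e x‖ ^ 2 ∂G.edgeMeasure e ≤ G.mass u := by
  rw [mass_eq]; exact integral_sq_le_sum u e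

theorem mass_nonneg [Fintype E] (u : E → ℝ → ℂ) : 0 ≤ G.mass u :=
  Finset.sum_nonneg fun _ _ => integral_nonneg fun _ => by positivity

theorem HasL2Deriv.exists_bound [Fintype E] {u g : E → ℝ → ℂ} (h : G.HasL2Deriv u g) :
    ∃ K, 0 ≤ K ∧ ∀ e, G.len e ≠ 0 → ∀ x ∈ G.interval e, ‖u e x‖ ≤ K := by
  obtain ⟨A, -, hA⟩ := HasL2Deriv.exists_norm_sq_le G
  exact ⟨_, Real.sqrt_nonneg _, fun e he x hx => Real.le_sqrt_of_sq_le (hA u g h e he x hx)⟩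

/-- Bounded sequences in `H¹(G)` have subsequences that converge pointwise and such that the
derivatives converge weakly. -/
theorem HasL2Deriv.exists_subseq_tendsto [Finite V] [Fintype E] (hconn : G.Connected)
    (hnc : G.Noncompact) {u g : ℕ → E → ℝ → ℂ} (h : ∀ n, G.HasL2Deriv (u n) (g n)) {μ T K : ℝ}
    (hm : ∀ n, G.mass (u n) ≤ μ) (hT : ∀ n, ∑ e, ∫ x, ‖g n e x‖ ^ 2 ∂G.edgeMeasure e ≤ T)
    (hK : ∀ n e, G.len e ≠ 0 → ∀ x ∈ G.interval e, ‖u n e x‖ ≤ K) :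
    ∃ (v k : E → ℝ → ℂ) (φ : ℕ → ℕ), G.HasL2Deriv v k ∧ StrictMono φ ∧
      (∀ e, ∀ x ∈ G.interval e, Tendsto (fun n => u (φ n) e x) atTop (𝓝 (v e x))) ∧
      ∀ e, Tendsto (fun n => ∫ x, inner ℂ (g (φ n) e x) (k e x) ∂G.edgeMeasure e) atTop
        (𝓝 (∫ x, inner ℂ (k e x) (k e x) ∂G.edgeMeasure e)) := by
  cases nonempty_fintype V
  choose c hcK hc using fun n => (h n).exists_bounded_vertex hconn hnc (hK n)
  have hK0 : 0 ≤ K := by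
    obtain ⟨e₀, -⟩ := hnc
    exact (norm_nonneg _).trans (hcK 0 (G.src e₀))
  -- As `V` is finite, the vertex values lie in a ball of a finite-dimensional space; they supply
  -- the integration constants that weak convergence of the derivatives does not see.
  obtain ⟨c', -, φ₁, hφ₁, hcφ⟩ := tendsto_subseq_of_bounded
    (Metric.isBounded_closedBall (x := (0 : V → ℂ)) (r := K)) (x := c) (fun n => by
      rw [mem_closedBall_zero_iff, pi_norm_le_iff_of_nonneg hK0]
      exact hcK n)
  obtain ⟨k, φ₂, hk, hφ₂, hw⟩ := exists_subseq_tendsto_integral_inner G.edgeMeasure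
    (g := fun n => g (φ₁ n)) (fun n e => (h (φ₁ n)).deriv_memLp e) (C := T)
    (fun n e => (integral_sq_le_sum _ e).trans (hT _))
  have hcv : ∀ v, Tendsto (fun n => c (φ₁ (φ₂ n)) v) atTop (𝓝 (c' v)) := fun v =>
    ((tendsto_pi_nhds.1 hcφ v).comp hφ₂.tendsto_atTop)
  let v : E → ℝ → ℂ := fun e x => c' (G.src e) + ∫ t in (0 : ℝ)..x, k e t
  have hv : ∀ e, ∀ x ∈ G.interval e,
      Tendsto (fun n => u (φ₁ (φ₂ n)) e x) atTop (𝓝 (v e x)) := by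
    intro e x hx
    have hz := G.zero_mem_interval e
    -- Pairing with the indicator of `(0, x]` turns weak convergence of derivatives into pointwise
    -- convergence of primitives; the conjugation appears because `inner` is conjugate-linear in its
    -- first argument.
    let χ : ℝ → ℂ := (Ioc 0 x).indicator fun _ => 1
    have hχ : MemLp χ 2 (G.edgeMeasure e) := memLp_indicator_const 2 measurableSet_Ioc 1
      (Or.inr (ne_top_of_le_ne_top (by simp) (Measure.restrict_apply_le _ _)))
    have hint : ∀ f : ℝ → ℂ, ∫ t in (0 : ℝ)..x, f t =
        (starRingEnd ℂ) (∫ t, inner ℂ (f t) (χ t) ∂G.edgeMeasure e) := by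
      intro f
      rw [← integral_conj]
      have h1 : (fun t => (starRingEnd ℂ) (inner ℂ (f t) (χ t) : ℂ)) = (Ioc 0 x).indicator f := by
        funext t
        by_cases ht : t ∈ Ioc 0 x
        · simp [χ, ht]
        · simp [χ, ht]
      rw [h1, integral_indicator measurableSet_Ioc, ← G.restrict_interval,
        Measure.restrict_restrict measurableSet_Ioc, inter_eq_left.2
          (Ioc_subset_Icc_self.trans (G.Icc_subset_interval hx)),
        intervalIntegral.integral_of_le hx.1]
    have h2 : Tendsto (fun n => ∫ t in (0 : ℝ)..x, g (φ₁ (φ₂ n)) e t) atTop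
        (𝓝 (∫ t in (0 : ℝ)..x, k e t)) := by
      simp_rw [hint]
      exact (Complex.continuous_conj.tendsto _).comp (hw e χ hχ)
    refine ((hcv (G.src e)).add h2).congr fun n => ?_
    rw [(h _).eq_integral e x hx, (hc _ e).1]
  refine ⟨v, k, fun n => φ₁ (φ₂ n), ⟨⟨c', fun e => ⟨by simp [v], fun he => ?_⟩⟩, fun e => ?_, hk,
    fun e x hx => by simp [v]⟩, hφ₁.comp hφ₂, hv, fun e => hw e (k e) (hk e)⟩
  · refine tendsto_nhds_unique (hv e _ (G.toReal_len_mem_interval he)) ?_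
    exact (hcv (G.tgt e)).congr fun n => ((hc _ e).2 he).symm
  · have hae : ∀ᵐ x ∂G.edgeMeasure e, Tendsto (fun n => u (φ₁ (φ₂ n)) e x) atTop (𝓝 (v e x)) :=
      (G.ae_mem_interval e).mono (hv e)
    have hme : ∀ n, AEStronglyMeasurable (u (φ₁ (φ₂ n)) e) (G.edgeMeasure e) := fun n =>
      ((h _).memLp e).1
    refine ⟨aestronglyMeasurable_of_tendsto_ae _ hme hae, ?_⟩
    -- Fatou: the mass bound survives the pointwise limit.
    refine lt_of_le_of_lt (Lp.eLpNorm_le_of_ae_tendsto (C := ENNReal.ofReal (μ ^ (2⁻¹ : ℝ)))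
      (Eventually.of_forall fun n => ?_) hme hae) ENNReal.ofReal_lt_top
    rw [((h (φ₁ (φ₂ n))).memLp e).eLpNorm_eq_integral_rpow_norm (by norm_num) (by norm_num)]
    refine ENNReal.ofReal_le_ofReal ?_
    simp only [ENNReal.toReal_ofNat, Real.rpow_ofNat]
    exact Real.rpow_le_rpow (integral_nonneg fun x => by positivity)
      ((integral_sq_le_mass _ e).trans (hm _)) (by norm_num)

/-- The splitting of mass and energy along a weakly convergent sequence. -/
theorem HasL2Deriv.tendsto_sub [Fintype E] {u g : ℕ → E → ℝ → ℂ} {v k : E → ℝ → ℂ}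
    (h : ∀ n, G.HasL2Deriv (u n) (g n)) (hv : G.HasL2Deriv v k) {p μ K : ℝ} (hp : 2 < p)
    (hm : ∀ n, G.mass (u n) ≤ μ)
    (hK : ∀ n e, G.len e ≠ 0 → ∀ x ∈ G.interval e, ‖u n e x‖ ≤ K)
    (hlim : ∀ e, ∀ x ∈ G.interval e, Tendsto (fun n => u n e x) atTop (𝓝 (v e x)))
    (hw : ∀ e, Tendsto (fun n => ∫ x, inner ℂ (g n e x) (k e x) ∂G.edgeMeasure e) atTop
        (𝓝 (∫ x, inner ℂ (k e x) (k e x) ∂G.edgeMeasure e))) :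
    Tendsto (fun n => G.mass (u n) - G.mass (fun e x => u n e x - v e x)) atTop (𝓝 (G.mass v)) ∧
    Tendsto (fun n => G.energy p (u n) - G.energy p (fun e x => u n e x - v e x)) atTop
      (𝓝 (G.energy p v)) := by
  have hvK : ∀ e, G.len e ≠ 0 → ∀ x ∈ G.interval e, ‖v e x‖ ≤ K := fun e he x hx =>
    le_of_tendsto (hlim e x hx).norm (Eventually.of_forall fun n => hK n e he x hx)
  have hC : ∀ n e, ∫ x, ‖u n e x - v e x‖ ^ 2 ∂G.edgeMeasure e ≤ 2 * μ + 2 * G.mass v := by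
    intro n e
    have i1 := (h n).integrable_sq e
    have i2 := hv.integrable_sq e
    calc ∫ x, ‖u n e x - v e x‖ ^ 2 ∂G.edgeMeasure e
        ≤ ∫ x, (2 * ‖u n e x‖ ^ 2 + 2 * ‖v e x‖ ^ 2) ∂G.edgeMeasure e := by
          refine integral_mono (((h n).sub hv).integrable_sq e)
            ((i1.const_mul 2).add (i2.const_mul 2)) fun x => ?_
          simp only
          have h1 := pow_le_pow_left₀ (norm_nonneg _) (norm_sub_le (u n e x) (v e x)) 2
          nlinarith [sq_nonneg (‖u n e x‖ - ‖v e x‖)]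
      _ = 2 * (∫ x, ‖u n e x‖ ^ 2 ∂G.edgeMeasure e) + 2 * ∫ x, ‖v e x‖ ^ 2 ∂G.edgeMeasure e := by
          rw [integral_add (i1.const_mul 2) (i2.const_mul 2), integral_const_mul,
            integral_const_mul]
      _ ≤ _ := by
          have := (integral_sq_le_mass (G := G) (u n) e).trans (hm n)
          have := integral_sq_le_mass (G := G) v e
          linarith
  have hq : ∀ q : ℝ, 2 ≤ q → ∀ e, Tendsto (fun n => (∫ x, ‖u n e x‖ ^ q ∂G.edgeMeasure e) -
      ∫ x, ‖u n e x - v e x‖ ^ q ∂G.edgeMeasure e) atTop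
      (𝓝 (∫ x, ‖v e x‖ ^ q ∂G.edgeMeasure e)) := fun q hq e =>
    tendsto_integral_norm_rpow_sub hq (fun n => (h n).memLp e) (hv.memLp e)
      (fun n => ae_of_forall_mem_interval (hK n e)) (ae_of_forall_mem_interval (hvK e))
      (fun n => hC n e) ((G.ae_mem_interval e).mono (hlim e))
  constructor
  · simp_rw [mass_eq, ← Finset.sum_sub_distrib]
    refine tendsto_finsetSum _ fun e _ => ?_
    simpa using hq 2 le_rfl e
  · have h1 : Tendsto (fun n => ∑ e, ((∫ x, ‖g n e x‖ ^ 2 ∂G.edgeMeasure e) -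
        ∫ x, ‖g n e x - k e x‖ ^ 2 ∂G.edgeMeasure e)) atTop
        (𝓝 (∑ e, ∫ x, ‖k e x‖ ^ 2 ∂G.edgeMeasure e)) :=
      tendsto_finsetSum _ fun e _ => tendsto_integral_norm_sq_sub
        (fun n => (h n).deriv_memLp e) (hv.deriv_memLp e) (hw e)
    have h2 := tendsto_finsetSum Finset.univ fun e _ => hq p hp.le e
    have h3 := (h1.const_mul (1 / 2)).sub (h2.const_mul (1 / p))
    rw [hv.energy_eq]
    refine h3.congr fun n => ?_
    rw [(h n).energy_eq, ((h n).sub hv).energy_eq, Finset.sum_sub_distrib, Finset.sum_sub_distrib]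
    ring

/-- Scaling up to mass `μ` gives a lower bound on the energy of functions of smaller mass. -/
theorem HasL2Deriv.mass_div_mul_le_energy [Fintype E] {u g : E → ℝ → ℂ} (h : G.HasL2Deriv u g)
    {p μ I : ℝ} (hp : 2 < p) (hμ : 0 < μ) (hm : G.mass u ≤ μ)
    (hI : ∀ v, G.MemH1Mass μ v → I ≤ G.energy p v) :
    G.mass u / μ * I ≤ G.energy p u ∧
      (0 < G.mass u → G.mass u < μ → G.mass u / μ * I < G.energy p u) := by
  obtain ⟨K, hK0, hK⟩ := h.exists_bound
  have hp0 : 0 < p := by linarith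
  have hint := fun e => (h.memLp e).integrable_norm_rpow_of_bounded hp.le
    (ae_of_forall_mem_interval (hK e))
  set T := ∑ e, ∫ x, ‖g e x‖ ^ 2 ∂G.edgeMeasure e with hT
  set P := ∑ e, ∫ x, ‖u e x‖ ^ p ∂G.edgeMeasure e with hP
  have hE : G.energy p u = 1 / 2 * T - 1 / p * P := h.energy_eq p
  have hT0 : 0 ≤ T := Finset.sum_nonneg fun e _ => integral_nonneg fun x => by positivity
  have hPe : ∀ e, 0 ≤ ∫ x, ‖u e x‖ ^ p ∂G.edgeMeasure e := fun e =>
    integral_nonneg fun x => by positivity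
  have hP0 : 0 ≤ P := Finset.sum_nonneg fun e _ => hPe e
  have hPle : P ≤ K ^ (p - 2) * G.mass u := by
    rw [mass_eq, Finset.mul_sum]
    exact Finset.sum_le_sum fun e _ => (hint e).2
  rcases eq_or_lt_of_le (mass_nonneg (G := G) u) with h0 | h0
  · rw [← h0, mul_zero] at hPle
    refine ⟨?_, fun h => absurd h (by rw [← h0]; exact lt_irrefl 0)⟩
    rw [← h0, zero_div, zero_mul, hE, le_antisymm hPle hP0]
    linarith
  · have hPpos : 0 < P := by
      refine lt_of_le_of_ne hP0 fun hz => h0.ne' ?_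
      have h1 := (Finset.sum_eq_zero_iff_of_nonneg fun e _ => hPe e).1 hz.symm
      rw [mass_eq]
      refine Finset.sum_eq_zero fun e he => ?_
      have h2 := (integral_eq_zero_iff_of_nonneg (fun x => by positivity) (hint e).1).1 (h1 e he)
      refine integral_eq_zero_of_ae ?_
      filter_upwards [h2] with x hx
      have := (Real.rpow_eq_zero (norm_nonneg _) hp0.ne').1 hx
      simp [this]
    set m := G.mass u with hmdef
    -- Multiplying `u` by `√s` brings the mass to `μ`, scaling the kinetic term by `s` but the
    -- potential term by `s^(p/2)`. As `p > 2` the latter is at least `s`, and strictly larger when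
    -- `s > 1`.
    set s := μ / m with hs
    have hs1 : 1 ≤ s := (one_le_div h0).2 hm
    have hs0 : 0 < s := by positivity
    have hnorm : ∀ z : ℂ, ‖((√s : ℝ) : ℂ) * z‖ = √s * ‖z‖ := fun z => by
      rw [norm_mul, Complex.norm_real, Real.norm_eq_abs, abs_of_nonneg (Real.sqrt_nonneg s)]
    have hsc := h.const_mul ((√s : ℝ) : ℂ)
    have hsm : G.mass (fun e x => ((√s : ℝ) : ℂ) * u e x) = μ := by
      rw [mass_eq]
      simp_rw [hnorm, mul_pow, Real.sq_sqrt hs0.le, integral_const_mul, ← Finset.mul_sum]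
      rw [← mass_eq, ← hmdef, hs]
      field_simp
    have hsE : G.energy p (fun e x => ((√s : ℝ) : ℂ) * u e x) =
        1 / 2 * (s * T) - 1 / p * (s ^ (p / 2) * P) := by
      have h1 : √s ^ p = s ^ (p / 2) := by
        rw [Real.sqrt_eq_rpow, ← Real.rpow_mul hs0.le]
        ring_nf
      rw [hsc.energy_eq]
      simp_rw [hnorm, mul_pow, Real.sq_sqrt hs0.le,
        Real.mul_rpow (Real.sqrt_nonneg s) (norm_nonneg _), integral_const_mul, ← Finset.mul_sum,
        h1]
      rw [hT, hP]
    have hle := hI _ ⟨memH1_iff.2 ⟨_, hsc⟩, hsm⟩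
    rw [hsE] at hle
    have hms : m / μ = s⁻¹ := by rw [hs, inv_div]
    have hEs : G.energy p u = s⁻¹ * (1 / 2 * (s * T) - 1 / p * (s * P)) := by
      rw [hE]; field_simp
    rw [hms, hEs]
    have hpow : s ≤ s ^ (p / 2) := by
      nth_rewrite 1 [← Real.rpow_one s]
      exact Real.rpow_le_rpow_of_exponent_le hs1 (by linarith)
    constructor
    · refine mul_le_mul_of_nonneg_left (hle.trans ?_) (by positivity)
      have := mul_le_mul_of_nonneg_right hpow hP0
      have := mul_le_mul_of_nonneg_left this (by positivity : 0 ≤ 1 / p)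
      linarith
    · intro _ hlt
      have hs1' : 1 < s := (one_lt_div h0).2 hlt
      have hpow' : s < s ^ (p / 2) := by
        nth_rewrite 1 [← Real.rpow_one s]
        exact Real.rpow_lt_rpow_of_exponent_lt hs1' (by linarith)
      refine mul_lt_mul_of_pos_left (hle.trans_lt ?_) (by positivity)
      have := mul_lt_mul_of_pos_right hpow' hPpos
      have := mul_lt_mul_of_pos_left this (by positivity : 0 < 1 / p)
      linarith

end MetricGraph

/-! ### Vanishing sequences and the energy of the soliton -/

theorem solitonSpeed_le {p M K s : ℝ} (hp : 2 < p) (hM : 0 ≤ M) (hMK : M ≤ K) (hs : 0 ≤ s) :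
    solitonSpeed p M s ≤ √(2 / p) * √(K ^ (p - 2)) * s := by
  unfold solitonSpeed
  have h1 : √(M ^ (p - 2) - |s| ^ (p - 2)) ≤ √(K ^ (p - 2)) := by
    refine Real.sqrt_le_sqrt ?_
    have := Real.rpow_nonneg (abs_nonneg s) (p - 2)
    have := Real.rpow_le_rpow hM hMK (by linarith : 0 ≤ p - 2)
    linarith
  have h2 := mul_le_mul_of_nonneg_left h1 hs
  have h3 := mul_le_mul_of_nonneg_left h2 (Real.sqrt_nonneg (2 / p))
  linarith

/-- A bound uniform in `M ≤ K`: the vertex error must vanish along a sequence for which `M` varies.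
-/
theorem solitonAction_le {p M K s : ℝ} (hp : 2 < p) (hM : 0 ≤ M) (hMK : M ≤ K) (hs : 0 ≤ s) :
    solitonAction p M s ≤ √(2 / p) * √(K ^ (p - 2)) * s ^ 2 := by
  have h1 : solitonAction p M s ≤ ∫ _t in (0 : ℝ)..s, √(2 / p) * √(K ^ (p - 2)) * s := by
    refine intervalIntegral.integral_mono_on hs
      ((continuous_solitonSpeed hp M).intervalIntegrable _ _) (by simp) fun t ht => ?_
    exact (solitonSpeed_le hp hM hMK ht.1).trans
      (mul_le_mul_of_nonneg_left ht.2 (by positivity))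
  refine h1.trans (le_of_eq ?_)
  rw [intervalIntegral.integral_const, smul_eq_mul]
  ring

namespace MetricGraph

variable {V E : Type*} {G : MetricGraph V E} {u g : E → ℝ → ℂ}

theorem HasL2Deriv.integrable_deriv_mul_solitonSpeed (h : G.HasL2Deriv u g) {p M : ℝ} (hp : 2 < p)
    (hM : 0 ≤ M) (e : E) :
    Integrable (fun x => |solitonSpeed p M ‖u e x‖| * ‖g e x‖) (G.edgeMeasure e) := by
  have hmeas : AEStronglyMeasurable (fun x => solitonSpeed p M ‖u e x‖) (G.edgeMeasure e) :=
    (continuous_solitonSpeed hp M).comp_aestronglyMeasurable (h.memLp e).1.norm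
  refine ((h.integrable_mul e).const_mul (√(2 / p) * √(M ^ (p - 2)))).mono'
    (hmeas.norm.mul (h.deriv_memLp e).1.norm) (ae_of_all _ fun x => ?_)
  rw [norm_mul, norm_norm, Real.norm_eq_abs, abs_abs,
    abs_of_nonneg (solitonSpeed_nonneg p M (norm_nonneg _)), ← mul_assoc]
  exact mul_le_mul_of_nonneg_right (solitonSpeed_le hp hM le_rfl (norm_nonneg _)) (norm_nonneg _)

/-- The Modica trick: completing the square on an edge on which `|u| ≤ M`. -/
theorem HasL2Deriv.integral_deriv_mul_solitonSpeed_le (h : G.HasL2Deriv u g) {p M : ℝ} (hp : 2 < p)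
    (hM : 0 ≤ M) {e : E} (hle : ∀ x ∈ G.interval e, ‖u e x‖ ≤ M) :
    ∫ x, |solitonSpeed p M ‖u e x‖| * ‖g e x‖ ∂G.edgeMeasure e ≤
      1 / 2 * (∫ x, ‖g e x‖ ^ 2 ∂G.edgeMeasure e) - 1 / p * (∫ x, ‖u e x‖ ^ p ∂G.edgeMeasure e)
        + M ^ (p - 2) / p * ∫ x, ‖u e x‖ ^ 2 ∂G.edgeMeasure e := by
  have hae : ∀ᵐ x ∂G.edgeMeasure e, ‖u e x‖ ≤ M := (G.ae_mem_interval e).mono hle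
  have i1 : Integrable (fun x => 1 / 2 * ‖g e x‖ ^ 2) (G.edgeMeasure e) :=
    (h.integrable_deriv_sq e).const_mul _
  have i2 : Integrable (fun x => 1 / p * ‖u e x‖ ^ p) (G.edgeMeasure e) :=
    ((h.memLp e).integrable_norm_rpow_of_bounded hp.le hae).1.const_mul _
  have i3 : Integrable (fun x => M ^ (p - 2) / p * ‖u e x‖ ^ 2) (G.edgeMeasure e) :=
    (h.integrable_sq e).const_mul _
  have i12 : Integrable (fun x => 1 / 2 * ‖g e x‖ ^ 2 - 1 / p * ‖u e x‖ ^ p) (G.edgeMeasure e) :=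
    i1.sub i2
  rw [← integral_const_mul, ← integral_const_mul, ← integral_const_mul, ← integral_sub i1 i2,
    ← integral_add i12 i3]
  refine integral_mono_ae (h.integrable_deriv_mul_solitonSpeed hp hM e) (i12.add i3) ?_
  filter_upwards [hae] with x hx
  have h1 := solitonSpeed_sq hp (norm_nonneg (u e x)) hx
  have h2 := two_mul_le_add_sq |solitonSpeed p M ‖u e x‖| ‖g e x‖
  rw [sq_abs, h1] at h2
  have h3 : 2 / p * (M ^ (p - 2) * ‖u e x‖ ^ 2 - ‖u e x‖ ^ p) =
    2 * (M ^ (p - 2) / p * ‖u e x‖ ^ 2 - 1 / p * ‖u e x‖ ^ p) := by ring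
  linarith

/-- On a halfline the profile climbs from its value at the vertex to its maximum and decays. -/
theorem HasL2Deriv.two_mul_solitonAction_sub_le (h : G.HasL2Deriv u g) {p M : ℝ} (hp : 2 < p)
    (hM : 0 ≤ M) {e : E} (he : G.len e = ⊤) {x : ℝ} (hx : x ∈ G.interval e) :
    2 * solitonAction p M ‖u e x‖ - solitonAction p M ‖u e 0‖ ≤
      ∫ x, |solitonSpeed p M ‖u e x‖| * ‖g e x‖ ∂G.edgeMeasure e := by
  have h0 := G.zero_mem_interval e
  have hi := h.integrable_deriv_mul_solitonSpeed hp hM e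
  have key : ∀ᶠ y in atTop, 2 * solitonAction p M ‖u e x‖ - solitonAction p M ‖u e 0‖
      - solitonAction p M ‖u e y‖ ≤
      ∫ x, |solitonSpeed p M ‖u e x‖| * ‖g e x‖ ∂G.edgeMeasure e := by
    filter_upwards [eventually_ge_atTop x] with y hxy
    have hy : y ∈ G.interval e := by
      rw [G.interval_eq_Ici he]; exact hx.1.trans hxy
    have hy0 : 0 ≤ y := hy.1
    have h1 := (le_abs_self _).trans (h.abs_sub_comp_norm_le h0 hx hx.1
      (hasDerivAt_solitonAction hp M) (continuous_solitonSpeed hp M))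
    have h2 := (neg_abs_le _).trans' (neg_le_neg (h.abs_sub_comp_norm_le hx hy hxy
      (hasDerivAt_solitonAction hp M) (continuous_solitonSpeed hp M)))
    have hI : ∀ a b : ℝ, a ∈ G.interval e → b ∈ G.interval e →
        IntervalIntegrable (fun t => |solitonSpeed p M ‖u e t‖| * ‖g e t‖) volume a b :=
      fun a b ha hb => ⟨hi.mono_measure (G.restrict_Ioc_le ha hb),
        hi.mono_measure (G.restrict_Ioc_le hb ha)⟩
    have h3 := intervalIntegral.integral_add_adjacent_intervals (hI 0 x h0 hx) (hI x y hx hy)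
    have h4 : ∫ t in (0 : ℝ)..y, |solitonSpeed p M ‖u e t‖| * ‖g e t‖ ≤
        ∫ x, |solitonSpeed p M ‖u e x‖| * ‖g e x‖ ∂G.edgeMeasure e := by
      rw [intervalIntegral.integral_of_le hy0]
      exact integral_mono_measure (G.restrict_Ioc_le h0 hy) (ae_of_all _ fun t => by positivity) hi
    linarith
  have hlim : Tendsto (fun y => 2 * solitonAction p M ‖u e x‖ - solitonAction p M ‖u e 0‖
      - solitonAction p M ‖u e y‖) atTop
      (𝓝 (2 * solitonAction p M ‖u e x‖ - solitonAction p M ‖u e 0‖)) := by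
    have h1 := (hasDerivAt_solitonAction hp M 0).continuousAt.tendsto.comp
      (h.tendsto_atTop_zero he)
    have h2 : solitonAction p M 0 = 0 := by simp [solitonAction]
    rw [h2] at h1
    simpa using tendsto_const_nhds.sub h1
  exact le_of_tendsto hlim key

open Classical in
/-- The energy of the soliton is a lower bound, up to the contributions of the compact edges and
of the ends of the halflines. -/
theorem HasL2Deriv.lineEnergy_soliton_le [Fintype E] (hnc : G.Noncompact) (h : G.HasL2Deriv u g)
    {p μ K : ℝ} (hp2 : 2 < p) (hp6 : p < 6) (hμ : 0 < μ) (hm : G.mass u = μ)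
    (hK : ∀ e, G.len e ≠ 0 → ∀ x ∈ G.interval e, ‖u e x‖ ≤ K) :
    lineEnergy p (soliton p μ) ≤ G.energy p u + ∑ e,
      (if G.len e = ⊤ then √(2 / p) * √(K ^ (p - 2)) * ‖u e 0‖ ^ 2
        else 1 / p * ∫ x, ‖u e x‖ ^ p ∂G.edgeMeasure e) := by
  have hp : 0 < p := by linarith
  have hex : ∀ e : {e // G.len e = ⊤}, ∃ x ∈ G.interval e.1, ∀ y ∈ G.interval e.1,
      ‖u e.1 y‖ ≤ ‖u e.1 x‖ := fun e => h.exists_isMaxOn e.2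
  choose X hX hmax using hex
  obtain ⟨e₀, he₀⟩ := hnc
  have : Nonempty {e // G.len e = ⊤} := ⟨⟨e₀, he₀⟩⟩
  obtain ⟨⟨e₁, he₁⟩, hemax⟩ := Finite.exists_max fun e : {e // G.len e = ⊤} => ‖u e.1 (X e)‖
  set x₁ := X ⟨e₁, he₁⟩ with hx₁
  set M := ‖u e₁ x₁‖ with hMdef
  have hx₁I : x₁ ∈ G.interval e₁ := hX ⟨e₁, he₁⟩
  have hM : 0 ≤ M := norm_nonneg _
  have hMK : M ≤ K := hK e₁ (by simp [he₁]) x₁ hx₁I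
  have hle : ∀ e, G.len e = ⊤ → ∀ x ∈ G.interval e, ‖u e x‖ ≤ M := fun e he x hx =>
    (hmax ⟨e, he⟩ x hx).trans (hemax ⟨e, he⟩)
  set B := √(2 / p) * √(K ^ (p - 2)) with hB
  set r : E → ℝ := fun e => if G.len e = ⊤ then B * ‖u e 0‖ ^ 2
        else 1 / p * ∫ x, ‖u e x‖ ^ p ∂G.edgeMeasure e with hr
  -- Only the halfline carrying the maximum contributes the action. Other halflines contribute a
  -- nonnegative integral. On compact edges `‖u‖` may exceed `M`, so the square cannot be completed
  -- and `r e` simply cancels the potential term.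
  have hedge : ∀ e, (if e = e₁ then 2 * solitonAction p M M else 0) ≤
      1 / 2 * (∫ x, ‖g e x‖ ^ 2 ∂G.edgeMeasure e) - 1 / p * (∫ x, ‖u e x‖ ^ p ∂G.edgeMeasure e)
        + M ^ (p - 2) / p * (∫ x, ‖u e x‖ ^ 2 ∂G.edgeMeasure e) + r e := by
    intro e
    by_cases he : G.len e = ⊤
    · have h1 := h.integral_deriv_mul_solitonSpeed_le hp2 hM (hle e he)
      have hre : r e = B * ‖u e 0‖ ^ 2 := if_pos he
      split_ifs with hee
      · subst hee
        have h2 := h.two_mul_solitonAction_sub_le hp2 hM he hx₁I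
        rw [← hMdef] at h2
        have h3 := solitonAction_le (s := ‖u e 0‖) hp2 hM hMK (norm_nonneg _)
        linarith
      · have h2 : 0 ≤ ∫ x, |solitonSpeed p M ‖u e x‖| * ‖g e x‖ ∂G.edgeMeasure e :=
          integral_nonneg fun x => by positivity
        have h3 : 0 ≤ B * ‖u e 0‖ ^ 2 := by positivity
        linarith
    · have hre : r e = 1 / p * ∫ x, ‖u e x‖ ^ p ∂G.edgeMeasure e := if_neg he
      have hee : e ≠ e₁ := fun hh => he (hh ▸ he₁)
      rw [if_neg hee, hre]
      have h1 : 0 ≤ ∫ x, ‖g e x‖ ^ 2 ∂G.edgeMeasure e := integral_nonneg fun x => by positivity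
      have h2 : 0 ≤ M ^ (p - 2) / p * ∫ x, ‖u e x‖ ^ 2 ∂G.edgeMeasure e :=
        mul_nonneg (by positivity) (integral_nonneg fun x => by positivity)
      linarith
  have hsum := Finset.sum_le_sum fun e (_ : e ∈ Finset.univ) => hedge e
  rw [Finset.sum_ite_eq' Finset.univ e₁, if_pos (Finset.mem_univ e₁), Finset.sum_add_distrib,
    Finset.sum_add_distrib, Finset.sum_sub_distrib, ← Finset.mul_sum, ← Finset.mul_sum,
    ← Finset.mul_sum, ← h.energy_eq, ← mass_eq, hm] at hsum
  have hsol := _root_.lineEnergy_soliton_le hp2 hp6 hμ hM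
  have : μ / p * M ^ (p - 2) = M ^ (p - 2) / p * μ := by ring
  linarith

/-- If a bounded sequence of mass `μ` vanishes in the limit, its energies are asymptotically at
least the energy of the soliton. -/
theorem HasL2Deriv.lineEnergy_soliton_le_of_tendsto [Fintype E] (hnc : G.Noncompact)
    {u g : ℕ → E → ℝ → ℂ} (h : ∀ n, G.HasL2Deriv (u n) (g n)) {p μ K I : ℝ} (hp2 : 2 < p)
    (hp6 : p < 6) (hμ : 0 < μ) (hm : ∀ n, G.mass (u n) = μ)
    (hK : ∀ n e, G.len e ≠ 0 → ∀ x ∈ G.interval e, ‖u n e x‖ ≤ K)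
    (hlim : ∀ e, G.len e ≠ 0 → ∀ x ∈ G.interval e, Tendsto (fun n => u n e x) atTop (𝓝 0))
    (hI : Tendsto (fun n => G.energy p (u n)) atTop (𝓝 I)) :
    lineEnergy p (soliton p μ) ≤ I := by
  classical
  have hp : 0 < p := by linarith
  have hr : Tendsto (fun n => ∑ e,
      (if G.len e = ⊤ then √(2 / p) * √(K ^ (p - 2)) * ‖u n e 0‖ ^ 2
        else 1 / p * ∫ x, ‖u n e x‖ ^ p ∂G.edgeMeasure e)) atTop (𝓝 (∑ _e : E, 0)) := by
    refine tendsto_finsetSum _ fun e _ => ?_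
    split_ifs with he
    · have h1 := (hlim e (by simp [he]) 0 (G.zero_mem_interval e)).norm
      simpa using (h1.pow 2).const_mul (√(2 / p) * √(K ^ (p - 2)))
    -- A compact edge has finite measure, so the constant `K ^ p` dominates.
    · have : IsFiniteMeasure (G.edgeMeasure e) := ⟨by
        rw [edgeMeasure, G.openInterval_eq_Ioo he]; simp⟩
      have h1 : Tendsto (fun n => ∫ x, ‖u n e x‖ ^ p ∂G.edgeMeasure e) atTop
          (𝓝 (∫ _x, (0 : ℝ) ∂G.edgeMeasure e)) := by
        refine tendsto_integral_of_dominated_convergence (fun _ => K ^ p)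
          (fun n => (((h n).memLp e).integrable_norm_rpow_of_bounded hp2.le
            (ae_of_forall_mem_interval (hK n e))).1.1) (integrable_const _) (fun n => ?_) ?_
        · filter_upwards [ae_of_forall_mem_interval (hK n e)] with x hx
          rw [Real.norm_eq_abs, abs_of_nonneg (by positivity)]
          exact Real.rpow_le_rpow (norm_nonneg _) hx hp.le
        · filter_upwards [ae_of_forall_mem_interval (hlim e)] with x hx
          have h2 := hx.norm.rpow_const (p := p) (Or.inr hp.le)
          simpa [Real.zero_rpow hp.ne'] using h2
      rw [integral_zero] at h1
      simpa using h1.const_mul (1 / p)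
  rw [Finset.sum_const_zero] at hr
  have h1 := hI.add hr
  rw [add_zero] at h1
  exact ge_of_tendsto h1 (Eventually.of_forall fun n =>
    (h n).lineEnergy_soliton_le hnc hp2 hp6 hμ (hm n) (hK n))

/-- Continuity upgrades almost everywhere to everywhere, endpoints included; the vanishing case
needs the limit to be 0 at the vertices of the halflines. -/
theorem HasL2Deriv.eq_zero_of_mass_eq_zero [Fintype E] (h : G.HasL2Deriv u g)
    (hm : G.mass u = 0) {e : E} (he : G.len e ≠ 0) {x : ℝ} (hx : x ∈ G.interval e) :
    u e x = 0 := by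
  have h1 : ∫ x, ‖u e x‖ ^ 2 ∂G.edgeMeasure e = 0 :=
    le_antisymm ((integral_sq_le_mass u e).trans hm.le) (integral_nonneg fun x => by positivity)
  have h2 := (integral_eq_zero_iff_of_nonneg (fun x => by positivity) (h.integrable_sq e)).1 h1
  have h3 : u e =ᵐ[volume.restrict (G.openInterval e)] fun _ => 0 := by
    filter_upwards [h2] with x hx
    simpa using hx
  have h4 : EqOn (u e) (fun _ => 0) (G.openInterval e) :=
    Measure.eqOn_open_of_ae_eq h3 (G.isOpen_openInterval e)
      ((h.continuousOn e).mono (G.openInterval_subset_interval e)) continuousOn_const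
  exact h4.of_subset_closure (h.continuousOn e) continuousOn_const
    (G.openInterval_subset_interval e) (G.interval_subset_closure he) hx

end MetricGraph

/-! ### The minimizing sequence -/

theorem corollary6p1 {V E : Type*} [Finite V] [Fintype E] (G : MetricGraph V E)
    (hconn : G.Connected) (hnc : G.Noncompact)
    (p : ℝ) (hp2 : 2 < p) (hp6 : p < 6) (μ : ℝ) (hμ : 0 < μ)
    (h : ∃ u : E → ℝ → ℂ, G.MemH1Mass μ u ∧ G.energy p u ≤ lineEnergy p (soliton p μ)) :
    ∃ u : E → ℝ → ℂ, G.IsGroundState p μ u := by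
  obtain ⟨u₀, hu₀, hu₀E⟩ := h
  obtain ⟨D, hD⟩ := G.exists_deriv_le_energy hp2 hp6 hμ
  set S : Set ℝ := G.energy p '' {u | G.MemH1Mass μ u} with hS
  have hSne : S.Nonempty := ⟨_, u₀, hu₀, rfl⟩
  have hSb : BddBelow S := by
    refine ⟨-D / 4, ?_⟩
    rintro _ ⟨v, ⟨hv, hvm⟩, rfl⟩
    obtain ⟨k, hk⟩ := MetricGraph.memH1_iff.1 hv
    have h1 := hD v k hk hvm
    have h2 : 0 ≤ ∑ e, ∫ x, ‖k e x‖ ^ 2 ∂G.edgeMeasure e :=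
      Finset.sum_nonneg fun e _ => integral_nonneg fun x => by positivity
    linarith
  set I := sInf S with hI
  have hImin : ∀ v, G.MemH1Mass μ v → I ≤ G.energy p v := fun v hv => csInf_le hSb ⟨v, hv, rfl⟩
  obtain ⟨a, -, ha, haS⟩ := exists_seq_tendsto_sInf hSne hSb
  choose u huM hua using haS
  choose g hg using fun n => MetricGraph.memH1_iff.1 (huM n).1
  have hm : ∀ n, G.mass (u n) = μ := fun n => (huM n).2
  have hE : Tendsto (fun n => G.energy p (u n)) atTop (𝓝 I) := ha.congr fun n => (hua n).symm
  obtain ⟨b, hb⟩ := hE.bddAbove_range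
  have hT : ∀ n, ∑ e, ∫ x, ‖g n e x‖ ^ 2 ∂G.edgeMeasure e ≤ 4 * b + D := fun n => by
    have h1 := hD _ _ (hg n) (hm n)
    have h2 : G.energy p (u n) ≤ b := hb ⟨n, rfl⟩
    linarith
  obtain ⟨A, -, hA⟩ := MetricGraph.HasL2Deriv.exists_norm_sq_le G
  set K := √(A * μ + 2 * (√μ * √(4 * b + D))) with hKdef
  have hK : ∀ n e, G.len e ≠ 0 → ∀ x ∈ G.interval e, ‖u n e x‖ ≤ K := fun n e he x hx => by
    have h1 := hA _ _ (hg n) e he x hx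
    rw [hm n] at h1
    refine Real.le_sqrt_of_sq_le (h1.trans ?_)
    have := Real.sqrt_le_sqrt (hT n)
    have := mul_le_mul_of_nonneg_left this (Real.sqrt_nonneg μ)
    linarith
  obtain ⟨v, k, φ, hv, hφ, hlim, hw⟩ := MetricGraph.HasL2Deriv.exists_subseq_tendsto hconn hnc hg
    (fun n => (hm n).le) hT hK
  have hEφ := hE.comp hφ.tendsto_atTop
  obtain ⟨hmass, henergy⟩ := MetricGraph.HasL2Deriv.tendsto_sub (fun n => hg (φ n)) hv hp2
    (fun n => (hm (φ n)).le) (fun n => hK (φ n)) hlim hw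
  simp_rw [hm] at hmass
  set m := G.mass v with hmdef
  have hwm : Tendsto (fun n => G.mass fun e x => u (φ n) e x - v e x) atTop (𝓝 (μ - m)) := by
    simpa using (tendsto_const_nhds (x := μ)).sub hmass
  have hwE : Tendsto (fun n => G.energy p fun e x => u (φ n) e x - v e x) atTop
      (𝓝 (I - G.energy p v)) := by
    simpa using hEφ.sub henergy
  have hmμ : m ≤ μ := by
    have := ge_of_tendsto hwm (Eventually.of_forall fun n => MetricGraph.mass_nonneg _)
    linarith
  rcases eq_or_lt_of_le (MetricGraph.mass_nonneg (G := G) v) with h0 | h0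
  -- Vanishing: the infimum is at least the soliton energy, hence at least the energy of the
  -- competitor `u₀`, which is therefore a minimizer.
  · have hsol := MetricGraph.HasL2Deriv.lineEnergy_soliton_le_of_tendsto hnc
      (fun n => hg (φ n)) hp2 hp6 hμ (fun n => hm (φ n)) (fun n => hK (φ n))
      (fun e he x hx => by
        have h1 := hlim e x hx
        rwa [hv.eq_zero_of_mass_eq_zero h0.symm he hx] at h1) hEφ
    exact ⟨u₀, hu₀, fun w hw => (hu₀E.trans hsol).trans (hImin w hw)⟩
  · have hwlow : (μ - m) / μ * I ≤ I - G.energy p v := by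
      refine le_of_tendsto_of_tendsto ((hwm.div_const μ).mul_const I) hwE ?_
      -- Because `m > 0`, the remainder eventually has mass at most `μ`, so the scaling bound
      -- applies to it.
      filter_upwards [hwm.eventually_le_const (by linarith : μ - m < μ)] with n hn
      exact (((hg (φ n)).sub hv).mass_div_mul_le_energy hp2 hμ hn hImin).1
    have hvlow : G.energy p v ≤ m / μ * I := by
      have : (μ - m) / μ * I = I - m / μ * I := by field_simp
      linarith
    have hmeq : m = μ := by
      by_contra hne
      -- Splitting the mass strictly would cost energy: `v` would lie strictly above `(m/μ) I`.
      exact absurd ((hv.mass_div_mul_le_energy hp2 hμ hmμ hImin).2 h0 (lt_of_le_of_ne hmμ hne))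
        (not_lt.2 hvlow)
    refine ⟨v, ⟨MetricGraph.memH1_iff.2 ⟨k, hv⟩, hmeq⟩, fun w hw => ?_⟩
    rw [hmeq, div_self hμ.ne', one_mul] at hvlow
    exact hvlow.trans (hImin w hw)
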